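/- Let $X$ be a real or complex Banach space with scalar field $\mathbb{K}$, let $\alpha$ be an isometric linear automorphism of $X$, let $B_1(X^*)$ be the closed unit ball of the dual with the weak$^*$ topology, and let $T_\alpha$ be the homeomorphism $\omega\mapsto\omega\circ\alpha$ of $B_1(X^*)$. Let $Z$ be a weak$^*$ closed subset of $B_1(X^*)$ with $T_\alpha(Z)\subseteq Z$ such that the natural linear map $X\to C(Z)$, $x\mapsto(\omega\mapsto\omega(x))$, is an isomorphism onto a closed linear subspace of $C(Z)$. Definitions. A CA embedding of $X$ is an isometric linear map $\iota:X\to Y$ into a Banach space such that for every finite $\Omega\subseteq X$ and $\delta>0$ there are an integer $d\ge1$ and contractive linear maps $\phi:X\to\ell_\infty^d$, $\psi:\ell_\infty^d\to Y$ with $\|\psi(\phi(x))-\iota(x)\|<\delta$ for all $x\in\Omega$; let $\mathrm{rc}(\Omega,\delta)$ be the least such $d$. Fix any CA embedding of $X$ (one exists: the evaluation map $X\to C(B_1(X^*))$) and put $$\mathrm{hc}(\alpha)=\sup_{\Omega\subseteq X\text{ finite}}\ \sup_{\delta>0}\ \limsup_{n\to\infty}\frac1n\log\mathrm{rc}\bigl(\Omega\cup\alpha\Omega\cup\dots\cup\alpha^{n-1}\Omega,\delta\bigr).$$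 A set $S\subseteq X$ is equivalent to the standard basis of $\ell_1^I$ if some bijection from that basis onto $S$ extends to an isomorphism $\gamma:\ell_1^I\to\overline{\mathrm{span}}\,S$, and $K$-equivalent if $\gamma$ can be chosen with $\|\gamma\|\,\|\gamma^{-1}\|\le K$. A set $I\subseteq\mathbb{Z}$ is an $\ell_1$-isomorphism set for $x\in X$ if $\{\alpha^i(x):i\in I\}$ is equivalent to the standard basis of $\ell_1^I$. The density of $I$ is $\lim_{n\to\infty}|I\cap\{-n,\dots,n\}|/(2n+1)$, when this limit exists. $\mathrm{h}_{\mathrm{top}}$ is the topological entropy of a continuous self-map of a compact Hausdorff space. A subset of $X$ is total if its linear span is dense. Then the following are equivalent: 1. $\mathrm{hc}(\alpha)>0$; 2. $\mathrm{h}_{\mathrm{top}}(T_\alpha)>0$; 3. $\mathrm{h}_{\mathrm{top}}(T_\alpha)=\infty$; 4. there exist an $x\in X$, constants $K\ge1$ and $d>0$, a sequence $(n_k)_{k\in\mathbb{N}}$ in $\mathbb{N}$ tending to infinity, and sets $I_k\subseteq\{0,1,\dots,n_k-1\}$ of cardinality at least $dn_k$ such that for each $k$ the set $\{\alpha^i(x):i\in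 I_k\}$ is $K$-equivalent to the standard basis of $\ell_1^{I_k}$; 5. there exists an $x\in X$ with an $\ell_1$-isomorphism set of positive density; 6. $\mathrm{h}_{\mathrm{top}}(T_\alpha|_Z)>0$. Moreover, for any given total subset $\Delta$ of $X$, these conditions are also equivalent to (4) with $x\in\Delta$ and to (5) with $x\in\Delta$. -/

import Mathlib

open Filter Topology

noncomputable section

namespace CAEntropy

/-! ### Contractive approximation entropy -/

section CA

variable {𝕜 X Y : Type*} [RCLike 𝕜] [NormedAddCommGroup X] [NormedSpace 𝕜 X]
  [NormedAddCommGroup Y] [NormedSpace 𝕜 Y]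

/-- `(φ, ψ, d)` belongs to `CA(γ, Ω, δ)`: the integer `d` is positive and `φ : X → ℓ_∞^d`,
`ψ : ℓ_∞^d → Y` are contractions with `‖ψ (φ x) - γ x‖ < δ` on `Ω`. The type `Fin d → 𝕜` carries
the supremum norm. -/
def IsCA (γ : X →L[𝕜] Y) (Ω : Set X) (δ : ℝ) (d : ℕ)
    (φ : X →L[𝕜] (Fin d → 𝕜)) (ψ : (Fin d → 𝕜) →L[𝕜] Y) : Prop :=
  0 < d ∧ ‖φ‖ ≤ 1 ∧ ‖ψ‖ ≤ 1 ∧ ∀ x ∈ Ω, ‖ψ (φ x) - γ x‖ < δ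

/-- A CA embedding: an isometric linear map `ι` such that `CA(ι, Ω, δ)` is nonempty for every
finite set `Ω` and every `δ > 0`. -/
def IsCAEmbedding (ι : X →ₗᵢ[𝕜] Y) : Prop :=
  ∀ (Ω : Finset X) (δ : ℝ), 0 < δ →
    ∃ (d : ℕ) (φ : X →L[𝕜] (Fin d → 𝕜)) (ψ : (Fin d → 𝕜) →L[𝕜] Y),
      IsCA ι.toContinuousLinearMap (Ω : Set X) δ d φ ψ

/-- `rc(Ω, δ)`, computed with the embedding `ι` (the infimum over the empty set is `⊤`). -/
def rc (ι : X →ₗᵢ[𝕜] Y) (Ω : Set X) (δ : ℝ) : ℕ∞ :=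
  sInf {m : ℕ∞ | ∃ (d : ℕ) (φ : X →L[𝕜] (Fin d → 𝕜)) (ψ : (Fin d → 𝕜) →L[𝕜] Y),
    IsCA ι.toContinuousLinearMap Ω δ d φ ψ ∧ m = d}

/-- The set `Ω ∪ αΩ ∪ ⋯ ∪ α^(n-1)Ω`. -/
def orbitUnion (α : X ≃ₗᵢ[𝕜] X) (Ω : Finset X) (n : ℕ) : Set X :=
  ⋃ i ∈ Finset.range n, (α ^ i : X ≃ₗᵢ[𝕜] X) '' (Ω : Set X)

/-- `hc(α, Ω, δ) = limsup (1/n) log rc(Ω ∪ αΩ ∪ ⋯ ∪ α^(n-1)Ω, δ)`. -/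
def hcAt (ι : X →ₗᵢ[𝕜] Y) (α : X ≃ₗᵢ[𝕜] X) (Ω : Finset X) (δ : ℝ) : EReal :=
  limsup (fun n : ℕ => ENNReal.log (rc ι (orbitUnion α Ω n) δ : ENNReal) / n) atTop

/-- The contractive approximation entropy `hc(α)`, computed with the CA embedding `ι`. -/
def hc (ι : X →ₗᵢ[𝕜] Y) (α : X ≃ₗᵢ[𝕜] X) : EReal :=
  ⨆ (Ω : Finset X) (δ : ℝ) (_ : 0 < δ), hcAt ι α Ω δ

end CA

/-! ### Topological entropy -/

/-- The topological entropy of a self-map of a compact Hausdorff space, with respect to the unique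
compatible uniformity. -/
def htop {K : Type*} [TopologicalSpace K] [CompactSpace K] [T2Space K] (T : K → K) : EReal :=
  letI : UniformSpace K := uniformSpaceOfCompactR1
  Dynamics.coverEntropy T Set.univ

/-- The topological entropy of the restriction of `T` to a closed invariant subset. -/
def htopRestrict {K : Type*} [TopologicalSpace K] [CompactSpace K] [T2Space K] (T : K → K)
    (Z : Set K) (hZ : IsClosed Z) (hT : Set.MapsTo T Z Z) : EReal :=
  haveI : CompactSpace Z := isCompact_iff_compactSpace.mp hZ.isCompact
  htop (hT.restrict T Z Z)

/-! ### The dual ball and the induced homeomorphism -/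

section Dual

variable (𝕜 X : Type*) [RCLike 𝕜] [NormedAddCommGroup X] [NormedSpace 𝕜 X]

/-- The closed unit ball `B_1(X^*)` of the dual, with the weak* topology. -/
abbrev DualBall : Type _ :=
  {ω : WeakDual 𝕜 X // ω ∈ WeakDual.toStrongDual ⁻¹' Metric.closedBall (0 : StrongDual 𝕜 X) 1}

instance : CompactSpace (DualBall 𝕜 X) :=
  isCompact_iff_compactSpace.mp (WeakDual.isCompact_closedBall (0 : StrongDual 𝕜 X) 1)

variable {𝕜 X}

/-- `ω ↦ ω ∘ α` on the dual ball. -/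
def dualBallMap (α : X ≃ₗᵢ[𝕜] X) (ω : DualBall 𝕜 X) : DualBall 𝕜 X :=
  ⟨StrongDual.toWeakDual
      ((WeakDual.toStrongDual ω.1).comp (α.toContinuousLinearEquiv : X →L[𝕜] X)), by
    have h : ‖WeakDual.toStrongDual ω.1‖ ≤ 1 := mem_closedBall_zero_iff.mp ω.2
    refine mem_closedBall_zero_iff.mpr
      (ContinuousLinearMap.opNorm_le_bound _ zero_le_one fun x => ?_)
    have h1 := (WeakDual.toStrongDual ω.1).le_of_opNorm_le h (α x)
    rwa [α.norm_map] at h1⟩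

theorem dualBallMap_apply (α : X ≃ₗᵢ[𝕜] X) (ω : DualBall 𝕜 X) (x : X) :
    (dualBallMap α ω).1 x = ω.1 (α x) := rfl

theorem continuous_dualBallMap (α : X ≃ₗᵢ[𝕜] X) : Continuous (dualBallMap (𝕜 := 𝕜) α) := by
  refine Continuous.subtype_mk (WeakDual.continuous_of_continuous_eval fun x => ?_) _
  exact (WeakDual.eval_continuous (α x)).comp continuous_subtype_val

/-- The weak* homeomorphism `T_α` of `B_1(X^*)`, `T_α(ω) = ω ∘ α`. -/
def dualHomeo (α : X ≃ₗᵢ[𝕜] X) : DualBall 𝕜 X ≃ₜ DualBall 𝕜 X where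
  toFun := dualBallMap α
  invFun := dualBallMap α.symm
  left_inv ω := Subtype.ext (DFunLike.ext _ _ fun x => by simp [dualBallMap_apply])
  right_inv ω := Subtype.ext (DFunLike.ext _ _ fun x => by simp [dualBallMap_apply])
  continuous_toFun := continuous_dualBallMap α
  continuous_invFun := continuous_dualBallMap α.symm

/-- The natural map `X → C(Z)`, `x ↦ (ω ↦ ω x)`, for a set `Z` of functionals in the dual ball. -/
def evalOn (Z : Set (DualBall 𝕜 X)) (x : X) : C(Z, 𝕜) where
  toFun z := z.1.1 x
  continuous_toFun :=
    (WeakDual.eval_continuous x).comp (continuous_subtype_val.comp continuous_subtype_val)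

/-- The canonical isometric embedding `X → C(B_1(X^*))`. -/
def ballEmbedding (𝕜 X : Type*) [RCLike 𝕜] [NormedAddCommGroup X] [NormedSpace 𝕜 X] :
    X →ₗᵢ[𝕜] C(DualBall 𝕜 X, 𝕜) where
  toFun x := ⟨fun ω => ω.1 x, (WeakDual.eval_continuous x).comp continuous_subtype_val⟩
  map_add' x y := by ext ω; exact map_add ω.1 x y
  map_smul' c x := by ext ω; exact map_smul ω.1 c x
  norm_map' x := by
    apply le_antisymm
    · refine (ContinuousMap.norm_le _ (norm_nonneg x)).mpr fun ω => ?_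
      have h : ‖WeakDual.toStrongDual ω.1‖ ≤ 1 := mem_closedBall_zero_iff.mp ω.2
      simpa using (WeakDual.toStrongDual ω.1).le_of_opNorm_le h x
    · obtain ⟨g, hg, hgx⟩ := exists_dual_vector'' 𝕜 x
      have h := ContinuousMap.norm_coe_le_norm
        (⟨fun ω => ω.1 x, (WeakDual.eval_continuous x).comp continuous_subtype_val⟩ :
          C(DualBall 𝕜 X, 𝕜))
        ⟨StrongDual.toWeakDual g, mem_closedBall_zero_iff.mpr hg⟩
      have h2 : ‖g x‖ = ‖x‖ := by rw [hgx]; simp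
      exact h2.symm.le.trans h

/-- The canonical embedding is a CA embedding; in particular CA embeddings exist. -/
theorem isCAEmbedding_ballEmbedding (𝕜 X : Type*) [RCLike 𝕜] [NormedAddCommGroup X]
    [NormedSpace 𝕜 X] : IsCAEmbedding (ballEmbedding 𝕜 X) := by
  intro Ω δ hδ
  let U : DualBall 𝕜 X → Set (DualBall 𝕜 X) := fun t => ⋂ x ∈ Ω, {s | ‖t.1 x - s.1 x‖ < δ / 2}
  have hUo : ∀ t, IsOpen (U t) := fun t =>
    isOpen_biInter_finset fun x _ => isOpen_lt
      ((continuous_const.sub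
        ((WeakDual.eval_continuous x).comp continuous_subtype_val)).norm) continuous_const
  have hUt : ∀ t, t ∈ U t := fun t => by simp [U, hδ]
  obtain ⟨F, hF⟩ := isCompact_univ.elim_finite_subcover U hUo
    (fun t _ => Set.mem_iUnion.mpr ⟨t, hUt t⟩)
  let e := F.equivFin
  let p : Fin F.card → DualBall 𝕜 X := fun j => (e.symm j).1
  have hcov : (Set.univ : Set (DualBall 𝕜 X)) ⊆ ⋃ j, U (p j) := by
    intro s hs
    obtain ⟨t, ht, hst⟩ := Set.mem_iUnion₂.mp (hF hs)
    exact Set.mem_iUnion.mpr ⟨e ⟨t, ht⟩, by simpa [p] using hst⟩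
  obtain ⟨f, hf⟩ := PartitionOfUnity.exists_isSubordinate_of_locallyFinite isClosed_univ
    (fun j => U (p j)) (fun j => hUo _) (locallyFinite_of_finite _) hcov
  have hsum : ∀ s, ∑ j, f j s = 1 := fun s => by
    rw [← finsum_eq_sum_of_fintype]; exact f.sum_eq_one (Set.mem_univ s)
  let φ : X →L[𝕜] (Fin F.card → 𝕜) :=
    ContinuousLinearMap.pi fun j => WeakDual.toStrongDual (p j).1
  let ψ₀ : (Fin F.card → 𝕜) →ₗ[𝕜] C(DualBall 𝕜 X, 𝕜) :=
    { toFun := fun c => ⟨fun s => ∑ j, c j * ((f j s : ℝ) : 𝕜), by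
        refine continuous_finsetSum _ fun j _ => continuous_const.mul ?_
        exact RCLike.continuous_ofReal.comp (f j).continuous⟩
      map_add' := fun a b => by
        ext s; simp [add_mul, Finset.sum_add_distrib]
      map_smul' := fun a b => by
        ext s; simp [Finset.mul_sum, mul_assoc] }
  have hψ : ∀ c, ‖ψ₀ c‖ ≤ 1 * ‖c‖ := fun c => by
    rw [one_mul]
    refine (ContinuousMap.norm_le _ (norm_nonneg c)).mpr fun s => ?_
    change ‖∑ j, c j * ((f j s : ℝ) : 𝕜)‖ ≤ ‖c‖
    calc ‖∑ j, c j * ((f j s : ℝ) : 𝕜)‖ ≤ ∑ j, ‖c‖ * f j s := by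
          refine norm_sum_le_of_le _ fun j _ => ?_
          rw [norm_mul, RCLike.norm_ofReal, abs_of_nonneg (f.nonneg j s)]
          exact mul_le_mul_of_nonneg_right (norm_le_pi_norm c j) (f.nonneg j s)
      _ = ‖c‖ := by rw [← Finset.mul_sum, hsum, mul_one]
  refine ⟨F.card, φ, ψ₀.mkContinuous 1 hψ, ?_, ?_, ψ₀.mkContinuous_norm_le zero_le_one hψ, ?_⟩
  · obtain ⟨t, ht, -⟩ := Set.mem_iUnion₂.mp
      (hF (Set.mem_univ (⟨0, mem_closedBall_zero_iff.mpr (by simp)⟩ : DualBall 𝕜 X)))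
    exact Finset.card_pos.mpr ⟨t, ht⟩
  · refine ContinuousLinearMap.opNorm_le_bound _ zero_le_one fun x => ?_
    rw [one_mul]
    refine (pi_norm_le_iff_of_nonneg (norm_nonneg x)).mpr fun j => ?_
    have h : ‖WeakDual.toStrongDual (p j).1‖ ≤ 1 := mem_closedBall_zero_iff.mp (p j).2
    simpa [φ] using (WeakDual.toStrongDual (p j).1).le_of_opNorm_le h x
  · intro x hx
    refine lt_of_le_of_lt ?_ (half_lt_self hδ)
    refine (ContinuousMap.norm_le _ (half_pos hδ).le).mpr fun s => ?_
    change ‖(∑ j, (p j).1 x * ((f j s : ℝ) : 𝕜)) - s.1 x‖ ≤ δ / 2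
    have h1 : s.1 x = ∑ j, s.1 x * ((f j s : ℝ) : 𝕜) := by
      rw [← Finset.mul_sum, ← RCLike.ofReal_sum, hsum]; simp
    rw [h1, ← Finset.sum_sub_distrib]
    calc _ ≤ ∑ j, δ / 2 * f j s := by
          refine norm_sum_le_of_le _ fun j _ => ?_
          rw [← sub_mul, norm_mul, RCLike.norm_ofReal, abs_of_nonneg (f.nonneg j s)]
          by_cases h0 : f j s = 0
          · simp [h0]
          · have hs : s ∈ U (p j) := hf j (subset_tsupport _ h0)
            exact mul_le_mul_of_nonneg_right
              (le_of_lt (Set.mem_iInter₂.mp hs x hx)) (f.nonneg j s)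
      _ = δ / 2 := by rw [← Finset.mul_sum, hsum, mul_one]

end Dual

/-! ### Sets equivalent to the standard basis of `ℓ₁` -/

section EllOne

variable (𝕜 : Type*) {X : Type*} [RCLike 𝕜] [NormedAddCommGroup X] [NormedSpace 𝕜 X]

open Classical in
/-- An isomorphism `γ` from `ℓ₁^I` onto the closed linear span of `S` which restricts to a bijection
from the standard basis onto `S`. -/
def MapsBasisOnto (I : Type*) (S : Set X)
    (γ : lp (fun _ : I => 𝕜) 1 ≃L[𝕜] (Submodule.span 𝕜 S).topologicalClosure) : Prop :=
  Set.BijOn (fun i : I => (γ (lp.single 1 i (1 : 𝕜)) : X)) Set.univ S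

/-- The set `S` is equivalent to the standard basis of `ℓ₁^I`. -/
def EquivStdBasis (I : Type*) (S : Set X) : Prop :=
  ∃ γ, MapsBasisOnto 𝕜 I S γ

/-- The set `S` is `C`-equivalent to the standard basis of `ℓ₁^I`. -/
def EquivStdBasisWith (C : ℝ) (I : Type*) (S : Set X) : Prop :=
  ∃ γ, MapsBasisOnto 𝕜 I S γ ∧
    ‖(γ : lp (fun _ : I => 𝕜) 1 →L[𝕜] (Submodule.span 𝕜 S).topologicalClosure)‖ *
      ‖(γ.symm : (Submodule.span 𝕜 S).topologicalClosure →L[𝕜] lp (fun _ : I => 𝕜) 1)‖ ≤ C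

variable {𝕜}

/-- `I ⊆ ℤ` is an `ℓ₁`-isomorphism set for `x`. -/
def IsEllOneIsomorphismSet (α : X ≃ₗᵢ[𝕜] X) (x : X) (I : Set ℤ) : Prop :=
  EquivStdBasis 𝕜 I ((fun i : ℤ => (α ^ i : X ≃ₗᵢ[𝕜] X) x) '' I)

/-- The orbit of `x` has pieces of proportional size that are uniformly equivalent to standard
bases of finite-dimensional `ℓ₁`-spaces. -/
def HasProportionalEllOnePieces (α : X ≃ₗᵢ[𝕜] X) (x : X) : Prop :=
  ∃ (C : ℝ) (d : ℝ) (n : ℕ → ℕ) (I : ℕ → Finset ℕ), 1 ≤ C ∧ 0 < d ∧ Tendsto n atTop atTop ∧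
    ∀ k, I k ⊆ Finset.range (n k) ∧ d * (n k : ℝ) ≤ ((I k).card : ℝ) ∧
      EquivStdBasisWith 𝕜 C (I k) ((fun i : ℕ => (α ^ i : X ≃ₗᵢ[𝕜] X) x) '' (I k : Set ℕ))

end EllOne

/-- The set `I ⊆ ℤ` has density `D`: the proportions of `I` in `{-n, …, n}` converge to `D`. -/
def HasDensity (I : Set ℤ) (D : ℝ) : Prop :=
  Tendsto (fun n : ℕ => ((I ∩ Set.Icc (-(n : ℤ)) (n : ℤ)).ncard : ℝ) / (2 * (n : ℝ) + 1))
    atTop (𝓝 D)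

/-- `x` has an `ℓ₁`-isomorphism set of positive density. -/
def HasPositiveDensityEllOneSet {𝕜 X : Type*} [RCLike 𝕜] [NormedAddCommGroup X] [NormedSpace 𝕜 X]
    (α : X ≃ₗᵢ[𝕜] X) (x : X) : Prop :=
  ∃ (I : Set ℤ) (D : ℝ), 0 < D ∧ HasDensity I D ∧ IsEllOneIsomorphismSet α x I

end CAEntropy

end

/-!
All conditions are compared with one statement about `x`: for some `r > 0` and `d > 0`, arbitrarily
long intervals `{0, …, n - 1}` contain sets `J` with `|J| ≥ d n` and
`r ∑_{i ∈ J} |cᵢ| ≤ ‖∑_{i ∈ J} cᵢ αⁱ x‖` for all scalars `cᵢ`.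

If `T_α` or its restriction to `Z` has positive entropy, there are exponentially many functionals
that are pairwise separated along the orbits of finitely many `x ∈ Δ`. A Sauer–Shelah argument makes
pairs of disjoint sets of values independent along a positive proportion of the times, and
the pigeonhole principle fixes `x` and the pair of values. Independence gives the lower
`ℓ₁`-estimate.

Conversely, a lower `ℓ₁`-estimate on `J` forces all `2 ^ |J|` sign sums `∑ ± αⁱ x` to have norm at
least `r |J|`, whereas by Hoeffding's inequality a single functional is large on an exponentially
small proportion of them only. So exponentially many functionals of `Z`, or coordinates of `ℓ_∞^d`,
are needed: `htop` of the restriction and `hc` are positive. For the whole dual ball, the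
Hahn–Banach theorem interpolates arbitrary values of size at most `r` on `J`, so that arbitrarily
fine grids of values give infinite entropy. Moreover `hc ≤ htop`, since a dynamical cover of the
dual ball yields an approximate factorization through `ℓ_∞^d`.

For positive density, the sets satisfying the estimate form a hereditary shift-invariant family, so
the maximal cardinality of a member in `{0, …, n - 1}` is subadditive in `n`. By compactness there
is one infinite set whose density is the limit of the proportions and all of whose finite subsets
satisfy the estimate.
-/

noncomputable section

namespace CAEntropy

section Shatter

variable {P ι : Type*}

/-- The set `S` shatters the index set `J` with respect to the pairs `(A i 1, A i (-1))`: every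
choice of one member of each pair indexed by `J` is realised by a point of `S`. This is the
combinatorial independence of the pairs. -/
def ShattersPairs (A : ι → ℤˣ → Set P) (S : Set P) (J : Finset ι) : Prop :=
  ∀ σ : ι → ℤˣ, ∃ p ∈ S, ∀ j ∈ J, p ∈ A j (σ j)

theorem ShattersPairs.mono {A : ι → ℤˣ → Set P} {S S' : Set P} {J : Finset ι}
    (h : ShattersPairs A S J) (hS : S ⊆ S') : ShattersPairs A S' J := fun σ =>
  let ⟨p, hp, hJ⟩ := h σ
  ⟨p, hS hp, hJ⟩

open Classical in
/-- The family of the subsets of `I` that `S` shatters. -/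
def shatteredIn (A : ι → ℤˣ → Set P) (S : Set P) (I : Finset ι) : Finset (Finset ι) :=
  I.powerset.filter (ShattersPairs A S)

theorem mem_shatteredIn {A : ι → ℤˣ → Set P} {S : Set P} {I J : Finset ι} :
    J ∈ shatteredIn A S I ↔ J ⊆ I ∧ ShattersPairs A S J := by
  simp only [shatteredIn, Finset.mem_filter, Finset.mem_powerset]

theorem shatteredIn_mono {A : ι → ℤˣ → Set P} {S S' : Set P} {I I' : Finset ι} (hS : S ⊆ S')
    (hI : I ⊆ I') : shatteredIn A S I ⊆ shatteredIn A S' I' := fun _ hJ =>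
  have ⟨hJI, hJS⟩ := mem_shatteredIn.mp hJ
  mem_shatteredIn.mpr ⟨hJI.trans hI, hJS.mono hS⟩

theorem ShattersPairs.insert [DecidableEq ι] {A : ι → ℤˣ → Set P} {S : Set P} {J : Finset ι}
    {i : ι} (h : ∀ u, ShattersPairs A (S ∩ A i u) J) : ShattersPairs A S (insert i J) := fun σ =>
  let ⟨p, hp, hJ⟩ := h (σ i) σ
  ⟨p, hp.1, (Finset.forall_mem_insert _ _ _).mpr ⟨hp.2, hJ⟩⟩

theorem card_shatteredIn_add_le [DecidableEq ι] (A : ι → ℤˣ → Set P) (S : Set P) {I : Finset ι}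
    {i : ι} (hi : i ∉ I) :
    (shatteredIn A (S ∩ A i 1) I).card + (shatteredIn A (S ∩ A i (-1)) I).card ≤
      (shatteredIn A S (insert i I)).card := by
  set F := shatteredIn A (S ∩ A i 1) I
  set G := shatteredIn A (S ∩ A i (-1)) I
  have notMem : ∀ J ∈ F ∪ G, i ∉ J := fun J hJ hiJ =>
    hi ((Finset.mem_union.mp hJ).elim (fun h => (mem_shatteredIn.mp h).1)
      (fun h => (mem_shatteredIn.mp h).1) hiJ)
  have insert_injOn : Set.InjOn (insert i) (F ∩ G : Set (Finset ι)) := fun J hJ J' hJ' h => by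
    rw [← Finset.erase_insert (notMem J (Finset.mem_union_left _ hJ.1)),
      ← Finset.erase_insert (notMem J' (Finset.mem_union_left _ hJ'.1)), h]
  have disjoint : Disjoint (F ∪ G) ((F ∩ G).image (insert i)) := by
    refine Finset.disjoint_left.mpr fun J hJ hJ' => notMem J hJ ?_
    obtain ⟨J₀, -, rfl⟩ := Finset.mem_image.mp hJ'
    exact Finset.mem_insert_self _ _
  rw [← Finset.card_union_add_card_inter,
    ← Finset.card_image_of_injOn (s := F ∩ G) (by simpa using insert_injOn),
    ← Finset.card_union_of_disjoint disjoint]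
  refine Finset.card_le_card (Finset.union_subset (Finset.union_subset ?_ ?_) ?_)
  · exact shatteredIn_mono Set.inter_subset_left (Finset.subset_insert _ _)
  · exact shatteredIn_mono Set.inter_subset_left (Finset.subset_insert _ _)
  · refine Finset.image_subset_iff.mpr fun J hJ => ?_
    obtain ⟨hF, hG⟩ := Finset.mem_inter.mp hJ
    refine mem_shatteredIn.mpr
      ⟨Finset.insert_subset_insert _ (mem_shatteredIn.mp hF).1, .insert fun u => ?_⟩
    rcases Int.units_eq_one_or u with rfl | rfl
    exacts [(mem_shatteredIn.mp hF).2, (mem_shatteredIn.mp hG).2]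

theorem exists_card_shatteredIn_inter_lt [DecidableEq ι] {A : ι → ℤˣ → Set P} {S : Set P}
    {I : Finset ι} {i : ι} (hi : i ∉ I) {M : ℕ}
    (h : (shatteredIn A S (insert i I)).card < 2 ^ (M + 1)) :
    ∃ u, (shatteredIn A (S ∩ A i u) I).card < 2 ^ M := by
  by_contra! hge
  have := card_shatteredIn_add_le A S hi
  have := hge 1
  have := hge (-1)
  omega

theorem eq_empty_of_card_shatteredIn_lt_one {A : ι → ℤˣ → Set P} {S : Set P} {I : Finset ι}
    (h : (shatteredIn A S I).card < 1) : S = ∅ := by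
  refine Set.not_nonempty_iff_eq_empty.mp fun ⟨p, hp⟩ => ?_
  have hmem : ∅ ∈ shatteredIn A S I :=
    mem_shatteredIn.mpr ⟨Finset.empty_subset I, fun _ => ⟨p, hp, by simp⟩⟩
  exact h.not_ge (Finset.card_pos.mpr ⟨∅, hmem⟩)

/-- The separation of the points of `S` by the pairs indexed by `I`. -/
def PairsSeparate (A : ι → ℤˣ → Set P) (I : Finset ι) (S : Set P) : Prop :=
  S.Pairwise fun p q => ∃ i ∈ I, ∃ u, p ∈ A i u ∧ q ∈ A i (-u)

theorem PairsSeparate.of_insert [DecidableEq ι] {A : ι → ℤˣ → Set P} {I : Finset ι} {i : ι}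
    {S S' : Set P} (h : PairsSeparate A (insert i I) S) (hS' : S' ⊆ S)
    (hi : ∀ u, ∀ p ∈ S' ∩ A i u, ∀ q ∈ S' ∩ A i (-u), False) : PairsSeparate A I S' := by
  intro p hp q hq hpq
  obtain ⟨j, hj, u, hpu, hqu⟩ := h (hS' hp) (hS' hq) hpq
  rcases Finset.mem_insert.mp hj with rfl | hjI
  · exact (hi u p ⟨hp, hpu⟩ q ⟨hq, hqu⟩).elim
  · exact ⟨j, hjI, u, hpu, hqu⟩

/-- A form of the Sauer–Shelah lemma for pairs that need not cover `P`. -/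
theorem encard_le_sum_choose_of_pairsSeparate {A : ι → ℤˣ → Set P}
    (I : Finset ι) (hA : ∀ i ∈ I, ∀ u, Disjoint (A i u) (A i (-u))) (S : Set P) (M : ℕ)
    (hS : PairsSeparate A I S) (hM : (shatteredIn A S I).card < 2 ^ M) :
    S.encard ≤ (∑ j ∈ Finset.range M, I.card.choose j : ℕ) := by
  classical
  induction I using Finset.induction_on generalizing S M with
  | empty =>
    rcases M with _ | M
    · simp [eq_empty_of_card_shatteredIn_lt_one hM]
    · have hsub : S.Subsingleton := fun p hp q hq => by
        by_contra hpq
        obtain ⟨i, hi, -⟩ := hS hp hq hpq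
        simp at hi
      rw [Finset.sum_range_succ']
      simpa using (Set.encard_le_one_iff_subsingleton.mpr hsub).trans (by simp)
  | insert i I hi ih =>
    rcases M with _ | M
    · simp [eq_empty_of_card_shatteredIn_lt_one hM]
    obtain ⟨u, hu⟩ := exists_card_shatteredIn_inter_lt hi hM
    have hA' := fun j hj => hA j (Finset.mem_insert_of_mem hj)
    have eq_or_neg_eq (v : ℤˣ) : v = u ∨ -v = u := by
      rcases Int.units_eq_one_or u with rfl | rfl <;>
        rcases Int.units_eq_one_or v with rfl | rfl <;>
        simp
    have diff_le := ih hA' (S \ A i u) (M + 1)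
      (hS.of_insert Set.sdiff_subset fun v p hp q hq => by
        rcases eq_or_neg_eq v with rfl | rfl
        exacts [hp.1.2 hp.2, hq.1.2 hq.2])
      (hM.trans_le' (Finset.card_le_card
        (shatteredIn_mono Set.sdiff_subset (Finset.subset_insert _ _))))
    have inter_le := ih hA' (S ∩ A i u) M
      (hS.of_insert Set.inter_subset_left fun v p hp q hq => by
        have hdisj := Set.disjoint_left.mp (hA i (Finset.mem_insert_self i I) v)
        rcases eq_or_neg_eq v with rfl | rfl
        exacts [hdisj hq.1.2 hq.2, hdisj hp.2 hp.1.2]) hu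
    rw [← Set.encard_sdiff_add_encard_inter S (A i u)]
    refine (add_le_add diff_le inter_le).trans ?_
    rw [← Nat.cast_add, Nat.cast_le, Finset.card_insert_of_notMem hi, Finset.sum_range_succ',
      Finset.sum_range_succ' _ M]
    simp only [Nat.choose_succ_succ', Finset.sum_add_distrib, Nat.choose_zero_right]
    omega

theorem sum_range_choose_mul_pow_le {t : ℝ} (ht : 0 ≤ t) (N M : ℕ) :
    ∑ j ∈ Finset.range M, (N.choose j : ℝ) * t ^ j ≤ (1 + t) ^ N := by
  have choose_vanishes : ∀ j ∈ Finset.range (max M (N + 1)), j ∉ Finset.range (N + 1) →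
      (N.choose j : ℝ) * t ^ j = 0 := fun j _ hj => by
    rw [Nat.choose_eq_zero_of_lt (by simpa using hj), Nat.cast_zero, zero_mul]
  calc ∑ j ∈ Finset.range M, (N.choose j : ℝ) * t ^ j
      ≤ ∑ j ∈ Finset.range (max M (N + 1)), (N.choose j : ℝ) * t ^ j :=
        Finset.sum_le_sum_of_subset_of_nonneg (Finset.range_subset_range.mpr (le_max_left _ _))
          fun _ _ _ => by positivity
    _ = ∑ j ∈ Finset.range (N + 1), (N.choose j : ℝ) * t ^ j :=
        (Finset.sum_subset (Finset.range_subset_range.mpr (le_max_right _ _))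
          choose_vanishes).symm
    _ = (1 + t) ^ N := by
        rw [add_comm 1 t, add_pow]
        exact Finset.sum_congr rfl fun j _ => by ring

theorem sum_range_choose_le_exp {b : ℝ} (hb : 0 < b) :
    ∃ c : ℝ, 0 < c ∧ ∀ N M : ℕ, (M : ℝ) ≤ c * N + 1 →
      ((∑ j ∈ Finset.range M, N.choose j : ℕ) : ℝ) ≤ Real.exp (b * N) := by
  obtain ⟨t, ht0, ht⟩ : ∃ t : ℝ, 0 < t ∧ t < min (b / 2) 1 := exists_between (by positivity)
  have htb : t ≤ b / 2 := ht.le.trans (min_le_left _ _)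
  have hlog : 0 < -Real.log t :=
    neg_pos.mpr (Real.log_neg ht0 (ht.trans_le (min_le_right _ _)))
  refine ⟨b / 2 / (-Real.log t), by positivity, fun N M hM => ?_⟩
  have one_le_weight : ∀ j ∈ Finset.range M, 1 ≤ Real.exp (b / 2 * N) * t ^ j := fun j hj => by
    have hjM : (j : ℝ) + 1 ≤ M := by exact_mod_cast Finset.mem_range.mp hj
    have hjN : (j : ℝ) * -Real.log t ≤ b / 2 * N := by
      rw [← le_div_iff₀ hlog, ← div_mul_eq_mul_div]
      linarith
    rw [← Real.exp_log (pow_pos ht0 j), ← Real.exp_add, Real.log_pow]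
    exact Real.one_le_exp (by linarith)
  push_cast
  calc ∑ j ∈ Finset.range M, (N.choose j : ℝ)
      ≤ ∑ j ∈ Finset.range M, Real.exp (b / 2 * N) * ((N.choose j : ℝ) * t ^ j) :=
        Finset.sum_le_sum fun j hj => by
          rw [mul_left_comm]
          exact le_mul_of_one_le_right (Nat.cast_nonneg _) (one_le_weight j hj)
    _ = Real.exp (b / 2 * N) * ∑ j ∈ Finset.range M, (N.choose j : ℝ) * t ^ j :=
        (Finset.mul_sum _ _ _).symm
    _ ≤ Real.exp (b / 2 * N) * (1 + t) ^ N := by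
        gcongr
        exact sum_range_choose_mul_pow_le ht0.le N M
    _ ≤ Real.exp (b / 2 * N) * Real.exp t ^ N := by
        gcongr
        linarith [Real.add_one_le_exp t]
    _ = Real.exp (b / 2 * N + N * t) := by rw [← Real.exp_nat_mul, ← Real.exp_add]
    _ ≤ Real.exp (b * N) := Real.exp_le_exp.mpr (by nlinarith [Nat.cast_nonneg (α := ℝ) N])

theorem card_shatteredIn_le_sum_choose {A : ι → ℤˣ → Set P} {S : Set P} {I : Finset ι} {m : ℕ}
    (h : ∀ J ⊆ I, ShattersPairs A S J → J.card < m) :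
    (shatteredIn A S I).card ≤ ∑ j ∈ Finset.range m, I.card.choose j := by
  classical
  have hsub : shatteredIn A S I ⊆ (Finset.range m).biUnion fun j => I.powersetCard j := by
    intro J hJ
    obtain ⟨hJI, hJS⟩ := mem_shatteredIn.mp hJ
    exact Finset.mem_biUnion.mpr ⟨J.card, Finset.mem_range.mpr (h J hJI hJS),
      Finset.mem_powersetCard.mpr ⟨hJI, rfl⟩⟩
  simpa only [Finset.card_powersetCard] using
    (Finset.card_le_card hsub).trans Finset.card_biUnion_le

theorem exists_shattersPairs_of_exp_lt_card {b : ℝ} (hb : 0 < b) :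
    ∃ c : ℝ, 0 < c ∧ ∀ {P ι : Type*} (A : ι → ℤˣ → Set P) (I : Finset ι) (S : Finset P),
      (∀ i ∈ I, ∀ u, Disjoint (A i u) (A i (-u))) → PairsSeparate A I S →
      Real.exp (b * I.card) < S.card →
      ∃ J ⊆ I, c * I.card ≤ J.card ∧ ShattersPairs A S J := by
  classical
  have hlog := Real.log_pos one_lt_two
  obtain ⟨c₁, hc₁, hchoose₁⟩ := sum_range_choose_le_exp hb
  obtain ⟨c₂, hc₂, hchoose₂⟩ := sum_range_choose_le_exp (mul_pos hc₁ hlog)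
  refine ⟨c₂, hc₂, fun {P ι} A I S hA hS hexp => ?_⟩
  by_contra! hJ
  set M := ⌊c₁ * I.card⌋₊ + 1 with hM
  have few_shattered : (shatteredIn A S I).card < 2 ^ M := by
    have hle : ((shatteredIn A S I).card : ℝ) ≤ Real.exp (c₁ * Real.log 2 * I.card) :=
      (Nat.cast_le.mpr (card_shatteredIn_le_sum_choose fun J hJI hJS =>
        Nat.lt_ceil.mpr (lt_of_not_ge fun hcard => hJ J hJI hcard hJS))).trans
      (hchoose₂ _ _ (Nat.ceil_lt_add_one (by positivity)).le)
    have hlt : Real.exp (c₁ * Real.log 2 * I.card) < 2 ^ M := by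
      rw [← Real.exp_log (pow_pos two_pos M), Real.log_pow, Real.exp_lt_exp, mul_right_comm, hM]
      push_cast
      exact mul_lt_mul_of_pos_right (Nat.lt_floor_add_one _) hlog
    exact_mod_cast hle.trans_lt hlt
  have hSM := encard_le_sum_choose_of_pairsSeparate I hA S M hS few_shattered
  rw [Set.encard_coe_eq_coe_finsetCard, Nat.cast_le] at hSM
  have hle : (S.card : ℝ) ≤ Real.exp (b * I.card) :=
    (Nat.cast_le.mpr hSM).trans (hchoose₁ _ _ (by
      rw [hM]
      push_cast
      linarith [Nat.floor_le (show 0 ≤ c₁ * I.card by positivity)]))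
  exact hexp.not_ge hle

end Shatter

section SignSums

theorem norm_le_abs_re_add_abs_im {𝕜 : Type*} [RCLike 𝕜] (z : 𝕜) :
    ‖z‖ ≤ |RCLike.re z| + |RCLike.im z| := by
  have hI : ‖(RCLike.I : 𝕜)‖ ≤ 1 := by
    rw [RCLike.norm_I]
    split_ifs <;> norm_num
  calc ‖z‖ = ‖(RCLike.re z : 𝕜) + RCLike.im z * RCLike.I‖ := by rw [RCLike.re_add_im]
    _ ≤ ‖(RCLike.re z : 𝕜)‖ + ‖(RCLike.im z : 𝕜)‖ * ‖(RCLike.I : 𝕜)‖ :=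
        (norm_add_le _ _).trans_eq (by rw [norm_mul])
    _ ≤ |RCLike.re z| + |RCLike.im z| := by
        rw [RCLike.norm_ofReal, RCLike.norm_ofReal]
        exact add_le_add le_rfl (mul_le_of_le_one_right (abs_nonneg _) hI)

theorem sum_exp_sign_sum_le {ι : Type*} [Fintype ι] [DecidableEq ι] {A : ℝ} {b : ι → ℝ}
    (hb : ∀ i, |b i| ≤ A) (l : ℝ) :
    ∑ σ : ι → ℤˣ, Real.exp (l * ∑ i, σ i • b i) ≤
      2 ^ Fintype.card ι * Real.exp (l ^ 2 * A ^ 2 / 2 * Fintype.card ι) := by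
  have factor_le : ∀ i, ∑ u : ℤˣ, Real.exp (l * u • b i) ≤ 2 * Real.exp (l ^ 2 * A ^ 2 / 2) := by
    intro i
    have hcosh : ∑ u : ℤˣ, Real.exp (l * u • b i) = 2 * Real.cosh (l * b i) := by
      rw [UnitsInt.univ, Finset.sum_pair (by decide), Real.cosh_eq]
      simp only [one_smul, Units.smul_def, Units.val_neg, Units.val_one, neg_smul, mul_neg]
      ring
    have hsq : b i ^ 2 ≤ A ^ 2 := sq_le_sq.mpr ((hb i).trans (le_abs_self A))
    rw [hcosh]
    gcongr
    refine (Real.cosh_le_exp_half_sq _).trans (Real.exp_le_exp.mpr ?_)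
    rw [mul_pow]
    gcongr
  calc ∑ σ : ι → ℤˣ, Real.exp (l * ∑ i, σ i • b i)
      = ∏ i, ∑ u : ℤˣ, Real.exp (l * u • b i) := by
        simp only [Fintype.prod_sum, Finset.mul_sum, Real.exp_sum]
    _ ≤ ∏ _i : ι, 2 * Real.exp (l ^ 2 * A ^ 2 / 2) :=
        Finset.prod_le_prod (fun _ _ => by positivity) fun i _ => factor_le i
    _ = _ := by
        rw [Finset.prod_const, Finset.card_univ, mul_pow, ← Real.exp_nat_mul,
          mul_comm (Fintype.card ι : ℝ)]

variable {𝕜 ι : Type*} [RCLike 𝕜] [Fintype ι] {A θ : ℝ}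

theorem card_sign_sum_ge_le [DecidableEq ι] (hA : 0 < A) (hθ : 0 ≤ θ) {b : ι → ℝ}
    (hb : ∀ i, |b i| ≤ A) :
    ((Finset.univ.filter fun σ : ι → ℤˣ => θ * Fintype.card ι ≤ ∑ i, σ i • b i).card : ℝ) ≤
      2 ^ Fintype.card ι * Real.exp (-(θ ^ 2 / (2 * A ^ 2) * Fintype.card ι)) := by
  set m : ℝ := (Fintype.card ι : ℝ)
  set l : ℝ := θ / A ^ 2 with hl
  set F := Finset.univ.filter fun σ : ι → ℤˣ => θ * m ≤ ∑ i, σ i • b i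
  have markov : F.card * Real.exp (l * (θ * m)) ≤
      2 ^ Fintype.card ι * Real.exp (l ^ 2 * A ^ 2 / 2 * m) := by
    calc F.card * Real.exp (l * (θ * m))
        ≤ ∑ σ ∈ F, Real.exp (l * ∑ i, σ i • b i) := by
          rw [← nsmul_eq_mul]
          refine Finset.card_nsmul_le_sum _ _ _ fun σ hσ => Real.exp_le_exp.mpr ?_
          exact mul_le_mul_of_nonneg_left (Finset.mem_filter.mp hσ).2 (by positivity)
      _ ≤ ∑ σ : ι → ℤˣ, Real.exp (l * ∑ i, σ i • b i) :=
          Finset.sum_le_sum_of_subset_of_nonneg (Finset.subset_univ F)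
            fun _ _ _ => (Real.exp_pos _).le
      _ ≤ _ := sum_exp_sign_sum_le hb l
  have hexp : -(θ ^ 2 / (2 * A ^ 2) * m) = l ^ 2 * A ^ 2 / 2 * m - l * (θ * m) := by
    rw [hl]
    field_simp
    ring
  rwa [hexp, Real.exp_sub, ← mul_div_assoc, le_div_iff₀ (Real.exp_pos _)]

theorem card_abs_sign_sum_ge_le [DecidableEq ι] (hA : 0 < A) (hθ : 0 ≤ θ) {b : ι → ℝ}
    (hb : ∀ i, |b i| ≤ A) :
    ((Finset.univ.filter fun σ : ι → ℤˣ => θ * Fintype.card ι ≤ |∑ i, σ i • b i|).card : ℝ) ≤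
      2 * (2 ^ Fintype.card ι * Real.exp (-(θ ^ 2 / (2 * A ^ 2) * Fintype.card ι))) := by
  have hsub : (Finset.univ.filter fun σ : ι → ℤˣ => θ * Fintype.card ι ≤ |∑ i, σ i • b i|) ⊆
      (Finset.univ.filter fun σ : ι → ℤˣ => θ * Fintype.card ι ≤ ∑ i, σ i • b i) ∪
        Finset.univ.filter fun σ : ι → ℤˣ => θ * Fintype.card ι ≤ ∑ i, σ i • (-b i) := by
    intro σ hσ
    simpa [smul_neg, le_abs] using hσ
  have hcard := (Finset.card_le_card hsub).trans (Finset.card_union_le _ _)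
  have hpos := card_sign_sum_ge_le hA hθ hb
  have hneg := card_sign_sum_ge_le hA hθ (b := fun i => -b i) fun i => by simpa using hb i
  rw [← Nat.cast_le (α := ℝ), Nat.cast_add] at hcard
  linarith

theorem card_norm_sign_sum_ge_le [DecidableEq ι] (hA : 0 < A) (hθ : 0 ≤ θ) {a : ι → 𝕜}
    (ha : ∀ i, ‖a i‖ ≤ A) :
    ((Finset.univ.filter fun σ : ι → ℤˣ => θ * Fintype.card ι ≤ ‖∑ i, σ i • a i‖).card : ℝ) ≤
      4 * (2 ^ Fintype.card ι * Real.exp (-(θ ^ 2 / (8 * A ^ 2) * Fintype.card ι))) := by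
  have hsub : (Finset.univ.filter fun σ : ι → ℤˣ => θ * Fintype.card ι ≤ ‖∑ i, σ i • a i‖) ⊆
      (Finset.univ.filter fun σ : ι → ℤˣ =>
        θ / 2 * Fintype.card ι ≤ |∑ i, σ i • RCLike.re (a i)|) ∪
      Finset.univ.filter fun σ : ι → ℤˣ =>
        θ / 2 * Fintype.card ι ≤ |∑ i, σ i • RCLike.im (a i)| := by
    intro σ hσ
    have hnorm := (Finset.mem_filter.mp hσ).2.trans (norm_le_abs_re_add_abs_im _)
    simp only [map_sum, Units.smul_def, map_zsmul] at hnorm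
    simp only [Finset.mem_union, Finset.mem_filter, Finset.mem_univ, true_and, Units.smul_def]
    by_contra! hlt
    linarith
  have hcard := (Finset.card_le_card hsub).trans (Finset.card_union_le _ _)
  have hre := card_abs_sign_sum_ge_le hA (div_nonneg hθ zero_le_two)
    fun i => (RCLike.abs_re_le_norm (a i)).trans (ha i)
  have him := card_abs_sign_sum_ge_le hA (div_nonneg hθ zero_le_two)
    fun i => (RCLike.abs_im_le_norm (a i)).trans (ha i)
  have hexp : (θ / 2) ^ 2 / (2 * A ^ 2) = θ ^ 2 / (8 * A ^ 2) := by
    field_simp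
    norm_num
  rw [hexp] at hre him
  rw [← Nat.cast_le (α := ℝ), Nat.cast_add] at hcard
  linarith

theorem exp_le_four_mul_card_of_sign_sums {τ : Type*} (s : Finset τ) (a : τ → ι → 𝕜) (hA : 0 < A)
    (hθ : 0 ≤ θ) (ha : ∀ t ∈ s, ∀ i, ‖a t i‖ ≤ A)
    (h : ∀ σ : ι → ℤˣ, ∃ t ∈ s, θ * Fintype.card ι ≤ ‖∑ i, σ i • a t i‖) :
    Real.exp (θ ^ 2 / (8 * A ^ 2) * Fintype.card ι) ≤ 4 * s.card := by
  classical
  set m := Fintype.card ι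
  set ε := Real.exp (-(θ ^ 2 / (8 * A ^ 2) * m)) with hε
  have hunion : (Finset.univ : Finset (ι → ℤˣ)) ⊆
      s.biUnion fun t => Finset.univ.filter fun σ => θ * m ≤ ‖∑ i, σ i • a t i‖ := by
    intro σ _
    obtain ⟨t, hts, ht⟩ := h σ
    exact Finset.mem_biUnion.mpr ⟨t, hts, Finset.mem_filter.mpr ⟨Finset.mem_univ σ, ht⟩⟩
  have hcount : (2 : ℝ) ^ m ≤ s.card * (4 * (2 ^ m * ε)) := by
    calc (2 : ℝ) ^ m = ((Finset.univ : Finset (ι → ℤˣ)).card : ℝ) := by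
          simp [m, Fintype.card_units_int]
      _ ≤ ∑ t ∈ s, ((Finset.univ.filter fun σ : ι → ℤˣ =>
            θ * m ≤ ‖∑ i, σ i • a t i‖).card : ℝ) := by
          exact_mod_cast (Finset.card_le_card hunion).trans Finset.card_biUnion_le
      _ ≤ ∑ _t ∈ s, 4 * (2 ^ m * ε) :=
          Finset.sum_le_sum fun t ht => card_norm_sign_sum_ge_le hA hθ (ha t ht)
      _ = _ := by rw [Finset.sum_const, nsmul_eq_mul]
  have hone : 1 ≤ 4 * s.card * ε := by
    refine le_of_mul_le_mul_left ?_ (show (0 : ℝ) < 2 ^ m by positivity)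
    linarith
  rwa [hε, Real.exp_neg, ← div_eq_mul_inv, one_le_div (Real.exp_pos _)] at hone

theorem exp_le_four_mul_card_of_finset_sign_sums {ι τ : Type*} (J : Finset ι) (s : Finset τ)
    (a : τ → ι → 𝕜) (hA : 0 < A) (hθ : 0 ≤ θ) (ha : ∀ t ∈ s, ∀ i ∈ J, ‖a t i‖ ≤ A)
    (h : ∀ σ : ι → ℤˣ, ∃ t ∈ s, θ * J.card ≤ ‖∑ i ∈ J, σ i • a t i‖) :
    Real.exp (θ ^ 2 / (8 * A ^ 2) * J.card) ≤ 4 * s.card := by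
  classical
  rw [← Fintype.card_coe J] at h ⊢
  refine exp_le_four_mul_card_of_sign_sums s (fun t (i : J) => a t i) hA hθ
    (fun t ht i => ha t ht i i.2) fun σ => ?_
  obtain ⟨t, hts, ht⟩ := h fun i => if hi : i ∈ J then σ ⟨i, hi⟩ else 1
  refine ⟨t, hts, ht.trans_eq ?_⟩
  rw [← Finset.sum_coe_sort]
  simp

end SignSums

section Density

variable {F : Set (Finset ℕ)}

open Classical in
/-- The largest cardinality of a member of `F` contained in `{0, …, n - 1}` (zero if there is no
such member). -/
def maxCard (F : Set (Finset ℕ)) (n : ℕ) : ℕ :=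
  ((Finset.range n).powerset.filter (· ∈ F)).sup Finset.card

theorem maxCard_le_iff {n m : ℕ} :
    maxCard F n ≤ m ↔ ∀ J ∈ F, J ⊆ Finset.range n → J.card ≤ m := by
  simp only [maxCard, Finset.sup_le_iff, Finset.mem_filter, Finset.mem_powerset]
  exact ⟨fun h J hJ hn => h J ⟨hn, hJ⟩, fun h J hJ => h J hJ.2 hJ.1⟩

theorem card_le_maxCard {J : Finset ℕ} {n : ℕ} (hJ : J ∈ F) (hn : J ⊆ Finset.range n) :
    J.card ≤ maxCard F n :=
  maxCard_le_iff.mp le_rfl J hJ hn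

theorem count_le_maxCard {I : Set ℕ} [DecidablePred (· ∈ I)]
    (hI : ∀ J : Finset ℕ, (J : Set ℕ) ⊆ I → J ∈ F) (n : ℕ) :
    Nat.count (· ∈ I) n ≤ maxCard F n := by
  rw [Nat.count_eq_card_filter_range]
  refine card_le_maxCard (hI _ fun i hi => ?_) (Finset.filter_subset _ _)
  exact (Finset.mem_filter.mp (Finset.mem_coe.mp hi)).2

theorem exists_mem_forall_mem_iff_add_mem (hF : IsLowerSet F)
    (hshift : ∀ (J : Finset ℕ) (a : ℕ), J.map (addRightEmbedding a) ∈ F → J ∈ F)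
    {J : Finset ℕ} (hJ : J ∈ F) (n : ℕ) :
    ∃ J' ∈ F, ∀ i, i ∈ J' ↔ i + n ∈ J := by
  refine ⟨J.preimage (· + n) (add_left_injective n).injOn, hshift _ n (hF ?_ hJ), by simp⟩
  intro i hi
  obtain ⟨j, hj, rfl⟩ := Finset.mem_map.mp hi
  exact Finset.mem_preimage.mp hj

theorem subset_range_of_mem_iff_add_mem {J J' : Finset ℕ} {n M : ℕ}
    (hJ : J ⊆ Finset.range (n + M)) (hJ' : ∀ i, i ∈ J' ↔ i + n ∈ J) : J' ⊆ Finset.range M := by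
  intro i hi
  have := Finset.mem_range.mp (hJ ((hJ' i).mp hi))
  exact Finset.mem_range.mpr (by omega)

theorem card_le_card_filter_lt_add_card {J J' : Finset ℕ} {n : ℕ}
    (hJ' : ∀ i, i ∈ J' ↔ i + n ∈ J) : J.card ≤ (J.filter (· < n)).card + J'.card := by
  rw [← Finset.card_filter_add_card_filter_not (s := J) (· < n),
    ← Finset.card_map (addRightEmbedding n) (s := J')]
  refine Nat.add_le_add_left (Finset.card_le_card fun i hi => ?_) _
  obtain ⟨hiJ, hin⟩ := Finset.mem_filter.mp hi
  have hsub : i - n + n = i := Nat.sub_add_cancel (not_lt.mp hin)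
  exact Finset.mem_map.mpr ⟨i - n, (hJ' _).mpr (by rwa [hsub]), hsub⟩

theorem subadditive_maxCard (hF : IsLowerSet F)
    (hshift : ∀ (J : Finset ℕ) (a : ℕ), J.map (addRightEmbedding a) ∈ F → J ∈ F) :
    Subadditive fun n => (maxCard F n : ℝ) := by
  intro n m
  rw [← Nat.cast_add, Nat.cast_le, maxCard_le_iff]
  intro J hJ hJn
  obtain ⟨J', hJ'F, hJ'⟩ := exists_mem_forall_mem_iff_add_mem hF hshift hJ n
  refine (card_le_card_filter_lt_add_card hJ').trans (add_le_add
    (card_le_maxCard (hF (Finset.filter_subset _ _) hJ) fun i hi => ?_)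
    (card_le_maxCard hJ'F (subset_range_of_mem_iff_add_mem hJn hJ')))
  exact Finset.mem_range.mpr (Finset.mem_filter.mp hi).2

theorem exists_tendsto_maxCard_div (hF : IsLowerSet F)
    (hshift : ∀ (J : Finset ℕ) (a : ℕ), J.map (addRightEmbedding a) ∈ F → J ∈ F) {d : ℝ}
    (hd : ∃ᶠ n : ℕ in atTop, ∃ J ∈ F, J ⊆ Finset.range n ∧ d * n ≤ J.card) :
    ∃ D, d ≤ D ∧ Tendsto (fun n : ℕ => (maxCard F n : ℝ) / n) atTop (𝓝 D) ∧
      ∀ n : ℕ, D * n ≤ maxCard F n := by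
  have hsub := subadditive_maxCard hF hshift
  have hbdd : BddBelow (Set.range fun n : ℕ => (maxCard F n : ℝ) / n) :=
    ⟨0, by rintro _ ⟨n, rfl⟩; positivity⟩
  refine ⟨hsub.lim, ge_of_tendsto_of_frequently (hsub.tendsto_lim hbdd) ?_,
    hsub.tendsto_lim hbdd, fun n => ?_⟩
  · refine (hd.and_eventually (eventually_gt_atTop 0)).mono ?_
    rintro n ⟨⟨J, hJ, hJn, hcard⟩, hn⟩
    rw [le_div_iff₀ (Nat.cast_pos.mpr hn)]
    exact hcard.trans (Nat.cast_le.mpr (card_le_maxCard hJ hJn))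
  · rcases Nat.eq_zero_or_pos n with rfl | hn
    · simp
    · exact (le_div_iff₀ (Nat.cast_pos.mpr hn)).mp (hsub.lim_le_div hbdd hn.ne')

/-- If no member of `F` had dense initial segments, then every member could be cut into short
sparse pieces, and `maxCard F` would grow too slowly. -/
theorem exists_mem_forall_le_card_filter_lt (hF : IsLowerSet F)
    (hshift : ∀ (J : Finset ℕ) (a : ℕ), J.map (addRightEmbedding a) ∈ F → J ∈ F) {D ε : ℝ}
    (hD : ∀ n : ℕ, D * n ≤ maxCard F n) (hε : 0 < ε) (hεD : ε ≤ D) (N : ℕ) :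
    ∃ J ∈ F, ∀ n ≤ N, (D - ε) * n ≤ (J.filter (· < n)).card := by
  by_contra! sparse
  have slope_nonneg : 0 ≤ D - ε := sub_nonneg.mpr hεD
  have card_le : ∀ M : ℕ, ∀ J ∈ F, J ⊆ Finset.range M → (J.card : ℝ) ≤ (D - ε) * M + N := by
    intro M
    induction M using Nat.strong_induction_on with
    | _ M ih =>
      intro J hJ hJM
      rcases le_total M N with hMN | hNM
      · have hJN : (J.card : ℝ) ≤ N :=
          Nat.cast_le.mpr (by simpa using (Finset.card_le_card hJM).trans (by simpa using hMN))
        exact hJN.trans (le_add_of_nonneg_left (mul_nonneg slope_nonneg M.cast_nonneg))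
      · obtain ⟨n, hnN, hlt⟩ := sparse J hJ
        have hn0 : n ≠ 0 := by rintro rfl; simp at hlt
        obtain ⟨k, rfl⟩ := Nat.exists_eq_add_of_le (hnN.trans hNM)
        obtain ⟨J', hJ'F, hJ'⟩ := exists_mem_forall_mem_iff_add_mem hF hshift hJ n
        have hJ'card := ih k (by omega) J' hJ'F (subset_range_of_mem_iff_add_mem hJM hJ')
        have hsplit : (J.card : ℝ) ≤ (J.filter (· < n)).card + J'.card :=
          mod_cast card_le_card_filter_lt_add_card hJ'
        push_cast
        linarith
  obtain ⟨M, hM⟩ := exists_nat_gt ((N : ℝ) / ε)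
  rw [div_lt_iff₀ hε] at hM
  have hbound : 0 ≤ (D - ε) * M + N := by positivity
  have hmax : (maxCard F M : ℝ) ≤ ⌊(D - ε) * M + N⌋₊ := Nat.cast_le.mpr
    (maxCard_le_iff.mpr fun J hJ hJM => Nat.le_floor (card_le M J hJ hJM))
  linarith [Nat.floor_le hbound, hD M]

theorem exists_set_frequently_forall_mem_iff (J : ℕ → Finset ℕ) :
    ∃ I : Set ℕ, ∀ n, ∃ᶠ N in atTop, ∀ i < n, (i ∈ I ↔ i ∈ J N) := by
  refine ⟨{i | ∀ᶠ N in (hyperfilter ℕ : Filter ℕ), i ∈ J N}, fun n => ?_⟩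
  refine Frequently.filter_mono (Eventually.frequently ?_) Nat.hyperfilter_le_atTop
  refine (eventually_all_finite (Set.finite_Iio n)).mpr fun i _ => ?_
  by_cases hi : ∀ᶠ N in (hyperfilter ℕ : Filter ℕ), i ∈ J N
  · exact hi.mono fun N hN => iff_of_true hi hN
  · exact (Ultrafilter.eventually_not.mpr hi).mono fun N hN => iff_of_false hi hN

open Classical in
theorem exists_tendsto_count_div (hF : IsLowerSet F)
    (hshift : ∀ (J : Finset ℕ) (a : ℕ), J.map (addRightEmbedding a) ∈ F → J ∈ F) {d : ℝ}
    (hd0 : 0 < d) (hd : ∃ᶠ n : ℕ in atTop, ∃ J ∈ F, J ⊆ Finset.range n ∧ d * n ≤ J.card) :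
    ∃ (I : Set ℕ) (D : ℝ), 0 < D ∧
      Tendsto (fun n : ℕ => (Nat.count (· ∈ I) n : ℝ) / n) atTop (𝓝 D) ∧
      ∀ J : Finset ℕ, (J : Set ℕ) ⊆ I → J ∈ F := by
  obtain ⟨D, hdD, hlim, hD⟩ := exists_tendsto_maxCard_div hF hshift hd
  have hD0 : 0 < D := hd0.trans_le hdD
  choose J hJF hJ using fun N : ℕ => exists_mem_forall_le_card_filter_lt hF hshift hD
    (ε := D / (N + 1)) (by positivity)
    (div_le_self hD0.le (by linarith [Nat.cast_nonneg (α := ℝ) N])) N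
  obtain ⟨I, hI⟩ := exists_set_frequently_forall_mem_iff J
  have hIF : ∀ J' : Finset ℕ, (J' : Set ℕ) ⊆ I → J' ∈ F := by
    intro J' hJ'
    obtain ⟨N, hN⟩ := (hI (J'.sup id + 1)).exists
    exact hF (fun i hi => (hN i (Nat.lt_succ_of_le (Finset.le_sup (f := id) hi))).mp (hJ' hi))
      (hJF N)
  have hlow : ∀ n : ℕ, D * n ≤ Nat.count (· ∈ I) n := by
    intro n
    have hε : Tendsto (fun N : ℕ => (D - D * (1 / ((N : ℝ) + 1))) * n) atTop
        (𝓝 ((D - D * 0) * n)) :=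
      ((tendsto_one_div_add_atTop_nhds_zero_nat.const_mul D).const_sub D).mul_const _
    rw [mul_zero, sub_zero] at hε
    refine le_of_tendsto_of_frequently hε
      (((hI n).and_eventually (eventually_ge_atTop n)).mono ?_)
    rintro N ⟨hN, hnN⟩
    rw [mul_one_div, Nat.count_eq_card_filter_range]
    refine (hJ N n hnN).trans (Nat.cast_le.mpr (Finset.card_le_card fun i hi => ?_))
    obtain ⟨hiJ, hin⟩ := Finset.mem_filter.mp hi
    exact Finset.mem_filter.mpr ⟨Finset.mem_range.mpr hin, (hN i hin).mpr hiJ⟩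
  refine ⟨I, D, hD0, tendsto_of_tendsto_of_tendsto_of_le_of_le' tendsto_const_nhds hlim ?_ ?_,
    hIF⟩
  · filter_upwards [eventually_gt_atTop 0] with n hn
    exact (le_div_iff₀ (Nat.cast_pos.mpr hn)).mpr (hlow n)
  · exact .of_forall fun n => div_le_div_of_nonneg_right
      (Nat.cast_le.mpr (count_le_maxCard hIF n)) (Nat.cast_nonneg _)

end Density

section EllOneLower

/-- The Banach space `ℓ₁^ι` over `𝕜`. -/
abbrev EllOne (𝕜 ι : Type*) [RCLike 𝕜] : Type _ := lp (fun _ : ι => 𝕜) 1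

variable (𝕜 : Type*) {X ι κ τ : Type*} [RCLike 𝕜] [NormedAddCommGroup X] [NormedSpace 𝕜 X]

/-- The family `y` satisfies the lower `ℓ₁`-estimate with constant `r` on the finite set `J`. -/
def EllOneLower (y : ι → X) (r : ℝ) (J : Finset ι) : Prop :=
  ∀ c : ι → 𝕜, r * ∑ i ∈ J, ‖c i‖ ≤ ‖∑ i ∈ J, c i • y i‖

variable {𝕜} {y : ι → X} {A r : ℝ} {J J' : Finset ι} {S : Set X}

theorem EllOneLower.mono (h : EllOneLower 𝕜 y r J) (hJ : J' ⊆ J) : EllOneLower 𝕜 y r J' := by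
  classical
  intro c
  simpa [apply_ite norm, ite_smul, Finset.sum_ite_mem, Finset.inter_eq_right.mpr hJ] using
    h fun i => if i ∈ J' then c i else 0

theorem ellOneLower_comp_linearIsometry {X' : Type*} [NormedAddCommGroup X'] [NormedSpace 𝕜 X']
    (β : X →ₗᵢ[𝕜] X') : EllOneLower 𝕜 (fun i => β (y i)) r J ↔ EllOneLower 𝕜 y r J := by
  refine forall_congr' fun c => ?_
  rw [← β.norm_map (∑ i ∈ J, c i • y i)]
  simp

theorem EllOneLower.of_map {y : κ → X} (e : ι ↪ κ) (h : EllOneLower 𝕜 y r (J.map e)) :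
    EllOneLower 𝕜 (y ∘ e) r J := fun c => by
  simpa [Finset.sum_map, e.injective.extend_apply] using h (Function.extend e c 0)

theorem EllOneLower.mul_card_le (h : EllOneLower 𝕜 y r J) (σ : ι → ℤˣ) :
    r * J.card ≤ ‖∑ i ∈ J, σ i • y i‖ := by
  simpa [← Units.smul_def, ← norm_units_zsmul (σ _) (1 : 𝕜)] using h fun i => σ i • (1 : 𝕜)

theorem EllOneLower.injective (hr : 0 < r) (h : ∀ J : Finset ι, EllOneLower 𝕜 y r J) :
    Function.Injective y := by
  classical
  intro i j hij
  by_contra hne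
  have hdiff := h {i, j} fun k => if k = i then 1 else -1
  rw [Finset.sum_pair hne, Finset.sum_pair hne] at hdiff
  simp [Ne.symm hne, hij] at hdiff
  linarith

section EllOneMap

theorem hasSum_norm_ellOne (f : EllOne 𝕜 ι) : HasSum (fun i => ‖f i‖) ‖f‖ := by
  simpa using lp.hasSum_norm (p := 1) (by simp) f

theorem norm_smul_le_mul_of_le (hA : ∀ i, ‖y i‖ ≤ A) (f : EllOne 𝕜 ι) (i : ι) :
    ‖f i • y i‖ ≤ A * ‖f i‖ := by
  rw [norm_smul, mul_comm]
  gcongr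
  exact hA i

variable [CompleteSpace X]

theorem summable_ellOne_smul (hA : ∀ i, ‖y i‖ ≤ A) (f : EllOne 𝕜 ι) :
    Summable fun i => f i • y i :=
  .of_norm_bounded ((hasSum_norm_ellOne f).summable.mul_left A) (norm_smul_le_mul_of_le hA f)

variable (𝕜 y) in
/-- The operator `ℓ₁ → X` sending the standard basis to a bounded family `y`. -/
def ellOneMap (hA : ∀ i, ‖y i‖ ≤ A) : EllOne 𝕜 ι →L[𝕜] X :=
  LinearMap.mkContinuous
    { toFun := fun f => ∑' i, f i • y i
      map_add' := fun f g => by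
        rw [← (summable_ellOne_smul hA f).tsum_add (summable_ellOne_smul hA g)]
        simp [add_smul]
      map_smul' := fun c f => by
        rw [RingHom.id_apply, ← (summable_ellOne_smul hA f).tsum_const_smul c]
        simp [mul_smul] } A fun f =>
    tsum_of_norm_bounded ((hasSum_norm_ellOne f).mul_left A) (norm_smul_le_mul_of_le hA f)

theorem hasSum_ellOneMap (hA : ∀ i, ‖y i‖ ≤ A) (f : EllOne 𝕜 ι) :
    HasSum (fun i => f i • y i) (ellOneMap 𝕜 y hA f) :=
  (summable_ellOne_smul hA f).hasSum

theorem norm_ellOneMap_apply_le (hA : ∀ i, ‖y i‖ ≤ A) (f : EllOne 𝕜 ι) :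
    ‖ellOneMap 𝕜 y hA f‖ ≤ A * ‖f‖ :=
  tsum_of_norm_bounded ((hasSum_norm_ellOne f).mul_left A) (norm_smul_le_mul_of_le hA f)

theorem ellOneMap_single [DecidableEq ι] (hA : ∀ i, ‖y i‖ ≤ A) (i : ι) :
    ellOneMap 𝕜 y hA (lp.single 1 i (1 : 𝕜)) = y i := by
  refine (hasSum_ellOneMap hA _).unique ?_
  convert hasSum_single (f := fun j => (lp.single 1 i (1 : 𝕜) : EllOne 𝕜 ι) j • y j) i
    fun j hj => ?_
  · simp
  · simp [hj]

theorem mul_norm_le_norm_ellOneMap (hA : ∀ i, ‖y i‖ ≤ A)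
    (h : ∀ J : Finset ι, EllOneLower 𝕜 y r J) (f : EllOne 𝕜 ι) :
    r * ‖f‖ ≤ ‖ellOneMap 𝕜 y hA f‖ :=
  le_of_tendsto_of_tendsto' ((hasSum_norm_ellOne f).const_mul r |>.trans_eq rfl)
    (hasSum_ellOneMap hA f).norm fun J => h J f

theorem antilipschitz_ellOneMap (hr : 0 < r) (hA : ∀ i, ‖y i‖ ≤ A)
    (h : ∀ J : Finset ι, EllOneLower 𝕜 y r J) :
    AntilipschitzWith (Real.toNNReal r⁻¹) (ellOneMap 𝕜 y hA) := by
  refine AddMonoidHomClass.antilipschitz_of_bound _ fun f => ?_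
  rw [Real.coe_toNNReal _ (by positivity), le_inv_mul_iff₀ hr]
  exact mul_norm_le_norm_ellOneMap hA h f

theorem range_ellOneMap (hr : 0 < r) (hA : ∀ i, ‖y i‖ ≤ A)
    (h : ∀ J : Finset ι, EllOneLower 𝕜 y r J) :
    LinearMap.range (ellOneMap 𝕜 y hA : EllOne 𝕜 ι →ₗ[𝕜] X) =
      (Submodule.span 𝕜 (Set.range y)).topologicalClosure := by
  classical
  apply le_antisymm
  · rintro _ ⟨f, rfl⟩
    refine (Submodule.isClosed_topologicalClosure _).mem_of_tendsto (hasSum_ellOneMap hA f)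
      (Eventually.of_forall fun J => Submodule.le_topologicalClosure _ ?_)
    exact Submodule.sum_mem _ fun i _ =>
      Submodule.smul_mem _ _ (Submodule.subset_span (Set.mem_range_self i))
  · refine Submodule.topologicalClosure_minimal _ (Submodule.span_le.mpr ?_) ?_
    · rintro _ ⟨i, rfl⟩
      exact ⟨lp.single 1 i (1 : 𝕜), ellOneMap_single hA i⟩
    · rw [LinearMap.coe_range]
      exact (antilipschitz_ellOneMap hr hA h).isClosed_range
        (ellOneMap 𝕜 y hA).uniformContinuous

theorem exists_equiv_of_ellOneLower (hr : 0 < r) (hA0 : 0 ≤ A) (hA : ∀ i, ‖y i‖ ≤ A)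
    (h : ∀ J : Finset ι, EllOneLower 𝕜 y r J) (hS : Set.range y = S) :
    ∃ γ : EllOne 𝕜 ι ≃L[𝕜] (Submodule.span 𝕜 S).topologicalClosure, MapsBasisOnto 𝕜 ι S γ ∧
      ‖γ.toContinuousLinearMap‖ ≤ A ∧ ‖γ.symm.toContinuousLinearMap‖ ≤ r⁻¹ := by
  classical
  subst hS
  let e : EllOne 𝕜 ι ≃ₗ[𝕜] (Submodule.span 𝕜 (Set.range y)).topologicalClosure :=
    (LinearEquiv.ofInjective (ellOneMap 𝕜 y hA : EllOne 𝕜 ι →ₗ[𝕜] X)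
      (antilipschitz_ellOneMap hr hA h).injective).trans
        (LinearEquiv.ofEq _ _ (range_ellOneMap hr hA h))
  have upper : ∀ f, ‖e f‖ ≤ A * ‖f‖ := norm_ellOneMap_apply_le hA
  have lower : ∀ v, ‖e.symm v‖ ≤ r⁻¹ * ‖v‖ := fun v => by
    have norm_eq : ‖ellOneMap 𝕜 y hA (e.symm v)‖ = ‖v‖ :=
      congrArg norm (congrArg Subtype.val (e.apply_symm_apply v))
    rw [le_inv_mul_iff₀ hr, ← norm_eq]
    exact mul_norm_le_norm_ellOneMap hA h _
  refine ⟨e.toContinuousLinearEquivOfBounds A r⁻¹ upper lower, ?_,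
    ContinuousLinearMap.opNorm_le_bound _ hA0 upper,
    ContinuousLinearMap.opNorm_le_bound _ (by positivity) lower⟩
  have basis : (fun i => (e (lp.single 1 i (1 : 𝕜)) : X)) = y := funext (ellOneMap_single hA)
  change Set.BijOn (fun i => (e (lp.single 1 i (1 : 𝕜)) : X)) Set.univ (Set.range y)
  rw [basis, ← Set.image_univ]
  exact (EllOneLower.injective hr h).injOn.bijOn_image

end EllOneMap

section MapsBasisOnto

theorem sum_norm_le_norm_sum_smul_single [DecidableEq ι] {T : Finset τ} {i : τ → ι}
    (hi : Set.InjOn i T) (c : τ → 𝕜) :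
    ∑ t ∈ T, ‖c t‖ ≤ ‖∑ t ∈ T, c t • (lp.single 1 (i t) (1 : 𝕜) : EllOne 𝕜 ι)‖ := by
  set f : EllOne 𝕜 ι := ∑ t ∈ T, c t • lp.single 1 (i t) (1 : 𝕜)
  have coord : ∀ t ∈ T, f (i t) = c t := fun t ht => by
    rw [lp.coeFn_sum, Finset.sum_apply, Finset.sum_eq_single_of_mem t ht]
    · simp
    · intro s hs hst
      simp [hi.ne ht hs hst.symm]
  calc ∑ t ∈ T, ‖c t‖ = ∑ k ∈ T.image i, ‖f k‖ := by
        rw [Finset.sum_image hi]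
        exact Finset.sum_congr rfl fun t ht => by rw [coord t ht]
    _ ≤ ‖f‖ := sum_le_hasSum _ (fun _ _ => norm_nonneg _) (hasSum_norm_ellOne f)

variable {γ : EllOne 𝕜 ι ≃L[𝕜] (Submodule.span 𝕜 S).topologicalClosure}

theorem norm_pos_of_mapsBasisOnto (hγ : MapsBasisOnto 𝕜 ι S γ) {v : X} (hv : v ∈ S) :
    0 < ‖v‖ := by
  classical
  obtain ⟨i, -, rfl⟩ := hγ.surjOn hv
  have single_ne_zero : (lp.single 1 i (1 : 𝕜) : EllOne 𝕜 ι) ≠ 0 :=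
    norm_pos_iff.mp (by rw [lp.norm_single (by simp), norm_one]; exact one_pos)
  rw [norm_pos_iff, Ne, Submodule.coe_eq_zero, γ.map_eq_zero_iff]
  convert single_ne_zero

theorem norm_le_of_mapsBasisOnto (hγ : MapsBasisOnto 𝕜 ι S γ) {v : X} (hv : v ∈ S) :
    ‖v‖ ≤ ‖γ.toContinuousLinearMap‖ := by
  classical
  obtain ⟨i, -, rfl⟩ := hγ.surjOn hv
  simpa [lp.norm_single] using γ.toContinuousLinearMap.le_opNorm (lp.single 1 i (1 : 𝕜))

theorem sum_norm_le_of_mapsBasisOnto (hγ : MapsBasisOnto 𝕜 ι S γ) {T : Finset τ} {z : τ → X}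
    (hz : Set.MapsTo z T S) (hinj : Set.InjOn z T) (c : τ → 𝕜) :
    ∑ t ∈ T, ‖c t‖ ≤ ‖γ.symm.toContinuousLinearMap‖ * ‖∑ t ∈ T, c t • z t‖ := by
  classical
  rcases T.eq_empty_or_nonempty with rfl | ⟨t₀, ht₀⟩
  · simp
  have preimage : ∀ t ∈ T, ∃ i : ι, (γ (lp.single 1 i (1 : 𝕜)) : X) = z t := fun t ht => by
    obtain ⟨i, -, hi⟩ := hγ.surjOn (hz ht)
    exact ⟨i, by convert hi⟩
  have : Nonempty ι := ⟨(preimage t₀ ht₀).choose⟩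
  choose! i hi using preimage
  have hiinj : Set.InjOn i T := fun s hs t ht hst =>
    hinj hs ht (by rw [← hi s hs, ← hi t ht, hst])
  set f : EllOne 𝕜 ι := ∑ t ∈ T, c t • lp.single 1 (i t) (1 : 𝕜) with hf
  have hγf : (γ f : X) = ∑ t ∈ T, c t • z t := by
    rw [hf, map_sum, Submodule.coe_sum]
    exact Finset.sum_congr rfl fun t ht => by rw [map_smul, Submodule.coe_smul, hi t ht]
  calc ∑ t ∈ T, ‖c t‖ ≤ ‖f‖ := sum_norm_le_norm_sum_smul_single hiinj c
    _ = ‖γ.symm.toContinuousLinearMap (γ f)‖ := by simp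
    _ ≤ _ := γ.symm.toContinuousLinearMap.le_opNorm _
    _ = _ := by rw [← hγf, Submodule.coe_norm]

end MapsBasisOnto

end EllOneLower

section HasDensity

theorem hasDensity_image_natCast {I : Set ℕ} {D : ℝ} [DecidablePred (· ∈ I)]
    (h : Tendsto (fun n => (Nat.count (· ∈ I) n : ℝ) / n) atTop (𝓝 D)) :
    HasDensity ((fun i : ℕ => (i : ℤ)) '' I) (D / 2) := by
  have count_eq : ∀ n : ℕ, ((fun i : ℕ => (i : ℤ)) '' I ∩ Set.Icc (-(n : ℤ)) n).ncard =
      Nat.count (· ∈ I) (n + 1) := fun n => by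
    rw [Nat.count_eq_card_filter_range, ← Set.ncard_coe_finset,
      ← Set.ncard_image_of_injective _ (Nat.cast_injective (R := ℤ))]
    congr 1
    ext i
    simp only [Set.mem_inter_iff, Set.mem_image, Set.mem_Icc, Finset.coe_filter,
      Finset.mem_range, Set.mem_ofPred_eq]
    constructor
    · rintro ⟨⟨j, hj, rfl⟩, -, hjn⟩
      exact ⟨j, ⟨by omega, hj⟩, rfl⟩
    · rintro ⟨j, ⟨hjn, hj⟩, rfl⟩
      exact ⟨⟨j, hj, rfl⟩, by omega, by omega⟩
  have ratio : Tendsto (fun n : ℕ => (1 + 1 * n : ℝ) / (1 + 2 * n)) atTop (𝓝 (1 / 2)) :=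
    tendsto_add_mul_div_add_mul_atTop_nhds 1 1 1 two_ne_zero
  have hlim := (h.comp (tendsto_add_atTop_nat 1)).mul ratio
  rw [mul_one_div] at hlim
  refine hlim.congr fun n => ?_
  rw [count_eq, Function.comp_apply, Nat.cast_add_one, one_mul, add_comm (1 : ℝ) n,
    add_comm (1 : ℝ), div_mul_div_cancel₀ (by positivity)]

variable {I : Set ℤ} {D : ℝ}

theorem HasDensity.infinite (hD : 0 < D) (h : HasDensity I D) : I.Infinite := by
  intro hfin
  have bound_tendsto : Tendsto (fun n : ℕ => (I.ncard : ℝ) / (2 * (n : ℝ) + 1)) atTop (𝓝 0) :=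
    tendsto_const_nhds.div_atTop (tendsto_atTop_add_const_right _ _
      (tendsto_natCast_atTop_atTop.const_mul_atTop two_pos))
  refine hD.not_ge (le_of_tendsto_of_tendsto' h bound_tendsto fun n => ?_)
  gcongr
  exact Set.inter_subset_left

open Classical in
theorem HasDensity.eventually_le_card (h : HasDensity I D) {d : ℝ} (hd : d < D) :
    ∀ᶠ n : ℕ in atTop, d * (2 * n + 1 : ℕ) ≤
      ({i ∈ Finset.range (2 * n + 1) | (i : ℤ) - n ∈ I} : Finset ℕ).card := by
  filter_upwards [Tendsto.eventually_const_lt hd h] with n hn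
  rw [lt_div_iff₀ (by positivity)] at hn
  push_cast
  refine hn.le.trans_eq ?_
  rw [← Set.ncard_coe_finset, ← Set.ncard_image_of_injective (f := fun i : ℕ => (i : ℤ) - n) _
    fun i j hij => by simpa using hij]
  congr 2
  ext i
  simp only [Set.mem_inter_iff, Set.mem_Icc, Finset.coe_filter, Finset.mem_range,
    Set.mem_ofPred_eq, Set.mem_image]
  constructor
  · rintro ⟨hi, hni, hin⟩
    have cast_eq : (((i + n).toNat : ℕ) : ℤ) - n = i := by omega
    exact ⟨(i + n).toNat, ⟨by omega, by rwa [cast_eq]⟩, cast_eq⟩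
  · rintro ⟨j, ⟨hjn, hj⟩, rfl⟩
    exact ⟨hj, by omega, by omega⟩

end HasDensity

section Orbit

variable {𝕜 X ι κ : Type*} [RCLike 𝕜] [NormedAddCommGroup X] [NormedSpace 𝕜 X]
  {α : X ≃ₗᵢ[𝕜] X} {x : X}

/-- The orbit of `x` satisfies a uniform lower `ℓ₁`-estimate on sets of times of positive
proportion in arbitrarily long initial intervals. This is the common form in which conditions (4)
and (5) are used. -/
def HasProportionalLower (α : X ≃ₗᵢ[𝕜] X) (x : X) : Prop :=
  ∃ r d : ℝ, 0 < r ∧ 0 < d ∧ ∃ᶠ n : ℕ in atTop, ∃ J ⊆ Finset.range n,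
    d * n ≤ J.card ∧ EllOneLower 𝕜 (fun i : ℕ => (α ^ i : X ≃ₗᵢ[𝕜] X) x) r J

theorem zpow_add_apply (α : X ≃ₗᵢ[𝕜] X) (i j : ℤ) (x : X) :
    (α ^ (i + j) : X ≃ₗᵢ[𝕜] X) x = (α ^ i : X ≃ₗᵢ[𝕜] X) ((α ^ j : X ≃ₗᵢ[𝕜] X) x) := by
  rw [zpow_add, LinearIsometryEquiv.coe_mul, Function.comp_apply]

theorem EquivStdBasis.injOn_of_image {f : κ → X} {I : Finset κ}
    (h : EquivStdBasis 𝕜 I (f '' (I : Set κ))) : Set.InjOn f I := by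
  classical
  obtain ⟨γ, hγ⟩ := h
  rw [← Finset.card_image_iff, ← Set.ncard_coe_finset, Finset.coe_image, ← hγ.image_eq,
    hγ.injOn.ncard_image, Set.ncard_univ, Nat.card_eq_fintype_card, Fintype.card_coe]

theorem EquivStdBasisWith.ellOneLower {S : Set X} {C m : ℝ} {z : κ → X} {T : Finset κ}
    (h : EquivStdBasisWith 𝕜 C ι S) (hC : 0 < C) (hz : Set.MapsTo z T S)
    (hinj : Set.InjOn z T) (hm : ∀ t ∈ T, m ≤ ‖z t‖) : EllOneLower 𝕜 z (m / C) T := by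
  obtain ⟨γ, hγ, hnorm⟩ := h
  intro c
  rcases T.eq_empty_or_nonempty with rfl | ⟨t, ht⟩
  · simp
  have m_le : m ≤ ‖γ.toContinuousLinearMap‖ :=
    (hm t ht).trans (norm_le_of_mapsBasisOnto hγ (hz ht))
  rw [div_mul_eq_mul_div, div_le_iff₀' hC]
  calc m * ∑ t ∈ T, ‖c t‖
      ≤ ‖γ.toContinuousLinearMap‖ *
          (‖γ.symm.toContinuousLinearMap‖ * ‖∑ t ∈ T, c t • z t‖) := by
        gcongr
        exact sum_norm_le_of_mapsBasisOnto hγ hz hinj c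
    _ ≤ C * ‖∑ t ∈ T, c t • z t‖ := by
        rw [← mul_assoc]
        gcongr

theorem HasProportionalEllOnePieces.hasProportionalLower
    (h : HasProportionalEllOnePieces α x) : HasProportionalLower α x := by
  obtain ⟨C, d, n, I, hC, hd, hn, h⟩ := h
  have hx : 0 < ‖x‖ := by
    obtain ⟨k, hk⟩ := (hn.eventually_gt_atTop 0).exists
    obtain ⟨-, hcard, γ, hγ, -⟩ := h k
    have hpos : (0 : ℝ) < (I k).card := (mul_pos hd (Nat.cast_pos.mpr hk)).trans_le hcard
    obtain ⟨i, hi⟩ := Finset.card_pos.mp (Nat.cast_pos.mp hpos)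
    rw [← (α ^ i : X ≃ₗᵢ[𝕜] X).norm_map x]
    exact norm_pos_of_mapsBasisOnto hγ ⟨i, hi, rfl⟩
  refine ⟨‖x‖ / C, d, by positivity, hd, hn.frequently (Frequently.of_forall fun k => ?_)⟩
  obtain ⟨hsub, hcard, hI⟩ := h k
  exact ⟨I k, hsub, hcard, hI.ellOneLower (one_pos.trans_le hC) (Set.mapsTo_image _ _)
    (EquivStdBasis.injOn_of_image (hI.imp fun _ => And.left))
    fun i _ => ((α ^ i : X ≃ₗᵢ[𝕜] X).norm_map x).ge⟩

theorem HasProportionalLower.hasProportionalEllOnePieces [CompleteSpace X]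
    (h : HasProportionalLower α x) : HasProportionalEllOnePieces α x := by
  obtain ⟨r, d, hr, hd, h⟩ := h
  obtain ⟨n, hn, h⟩ := extraction_of_frequently_atTop h
  choose I hI hcard hlow using h
  refine ⟨max 1 (‖x‖ * r⁻¹), d, n, I, le_max_left _ _, hd, hn.tendsto_atTop, fun k =>
    ⟨hI k, hcard k, ?_⟩⟩
  obtain ⟨γ, hγ, upper, lower⟩ := exists_equiv_of_ellOneLower (𝕜 := 𝕜)
    (y := fun i : I k => (α ^ (i : ℕ) : X ≃ₗᵢ[𝕜] X) x) hr (norm_nonneg x)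
    (fun i => ((α ^ (i : ℕ) : X ≃ₗᵢ[𝕜] X).norm_map x).le)
    (fun J => ((hlow k).mono (Finset.map_subtype_subset J)).of_map (.subtype _))
    (Set.image_eq_range (fun i : ℕ => (α ^ i : X ≃ₗᵢ[𝕜] X) x) _).symm
  exact ⟨γ, hγ, (mul_le_mul upper lower (norm_nonneg _) (norm_nonneg _)).trans
    (le_max_right _ _)⟩

theorem isEllOneIsomorphismSet_image_natCast [CompleteSpace X] {I : Set ℕ} {r : ℝ} (hr : 0 < r)
    (h : ∀ J : Finset ℕ, (J : Set ℕ) ⊆ I →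
      EllOneLower 𝕜 (fun i : ℕ => (α ^ i : X ≃ₗᵢ[𝕜] X) x) r J) :
    IsEllOneIsomorphismSet α x ((fun i : ℕ => (i : ℤ)) '' I) := by
  set Iz : Set ℤ := (fun i : ℕ => (i : ℤ)) '' I
  have toNat_spec : ∀ i : Iz, ((i : ℤ).toNat : ℤ) = i ∧ (i : ℤ).toNat ∈ I := by
    rintro ⟨_, j, hj, rfl⟩
    simpa using hj
  let e : Iz ↪ ℕ := ⟨fun i => (i : ℤ).toNat, fun i j hij => Subtype.ext (by
    rw [← (toNat_spec i).1, ← (toNat_spec j).1]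
    exact congrArg Nat.cast hij)⟩
  have orbit_eq : (fun i : Iz => (α ^ (i : ℤ) : X ≃ₗᵢ[𝕜] X) x) =
      (fun i : ℕ => (α ^ i : X ≃ₗᵢ[𝕜] X) x) ∘ e := funext fun i => by
    rw [← (toNat_spec i).1, zpow_natCast]
    rfl
  obtain ⟨γ, hγ, -⟩ := exists_equiv_of_ellOneLower (𝕜 := 𝕜)
    (y := fun i : Iz => (α ^ (i : ℤ) : X ≃ₗᵢ[𝕜] X) x) hr (norm_nonneg x)
    (fun i => ((α ^ (i : ℤ) : X ≃ₗᵢ[𝕜] X).norm_map x).le)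
    (fun J => orbit_eq ▸ (h (J.map e) fun i hi => by
      obtain ⟨j, -, rfl⟩ := Finset.mem_map.mp (Finset.mem_coe.mp hi)
      exact (toNat_spec j).2).of_map e)
    (Set.image_eq_range (fun i : ℤ => (α ^ i : X ≃ₗᵢ[𝕜] X) x) _).symm
  exact ⟨γ, hγ⟩

theorem HasProportionalLower.hasPositiveDensityEllOneSet [CompleteSpace X]
    (h : HasProportionalLower α x) : HasPositiveDensityEllOneSet α x := by
  classical
  obtain ⟨r, d, hr, hd, h⟩ := h
  have shift : ∀ (J : Finset ℕ) (a : ℕ),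
      EllOneLower 𝕜 (fun i : ℕ => (α ^ i : X ≃ₗᵢ[𝕜] X) x) r (J.map (addRightEmbedding a)) →
        EllOneLower 𝕜 (fun i : ℕ => (α ^ i : X ≃ₗᵢ[𝕜] X) x) r J := fun J a hJ => by
    rw [← ellOneLower_comp_linearIsometry (α ^ a : X ≃ₗᵢ[𝕜] X).toLinearIsometry]
    convert hJ.of_map _ using 2 with i
    simp [pow_add, add_comm i a]
  obtain ⟨I, D, hD, hlim, hI⟩ := exists_tendsto_count_div
    (F := {J | EllOneLower 𝕜 (fun i : ℕ => (α ^ i : X ≃ₗᵢ[𝕜] X) x) r J})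
    (fun J J' hJ' hJ => EllOneLower.mono hJ hJ') shift hd
    (h.mono fun n ⟨J, hJn, hcard, hJ⟩ => ⟨J, hJ, hJn, hcard⟩)
  exact ⟨_, D / 2, half_pos hD, hasDensity_image_natCast hlim,
    isEllOneIsomorphismSet_image_natCast hr hI⟩

theorem injective_orbit_of_infinite
    (h : (Set.range fun i : ℤ => (α ^ i : X ≃ₗᵢ[𝕜] X) x).Infinite) :
    Function.Injective fun i : ℤ => (α ^ i : X ≃ₗᵢ[𝕜] X) x := by
  intro i j heq
  by_contra hij
  refine h ?_
  have hper : Function.Periodic (fun i : ℤ => (α ^ i : X ≃ₗᵢ[𝕜] X) x) (j - i) := fun k => by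
    have zpow_eq : ∀ l : ℤ, (α ^ (k - i + l) : X ≃ₗᵢ[𝕜] X) x =
      (α ^ (k - i) : X ≃ₗᵢ[𝕜] X) ((α ^ l : X ≃ₗᵢ[𝕜] X) x) := fun l => zpow_add_apply _ _ _ _
    calc (α ^ (k + (j - i)) : X ≃ₗᵢ[𝕜] X) x
        = (α ^ (k - i) : X ≃ₗᵢ[𝕜] X) ((α ^ j : X ≃ₗᵢ[𝕜] X) x) := by rw [← zpow_eq]; congr 2; ring
      _ = (α ^ (k - i) : X ≃ₗᵢ[𝕜] X) ((α ^ i : X ≃ₗᵢ[𝕜] X) x) := congrArg _ heq.symm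
      _ = (α ^ k : X ≃ₗᵢ[𝕜] X) x := by rw [← zpow_eq, sub_add_cancel]
  rw [← hper.image_uIcc (sub_ne_zero.mpr (Ne.symm hij)) 0]
  exact (Set.finite_uIcc _ _).image _

theorem IsEllOneIsomorphismSet.exists_ellOneLower {I : Set ℤ}
    (h : IsEllOneIsomorphismSet α x I) (hI : I.Infinite) :
    ∃ r > 0, ∀ J : Finset ℤ, (J : Set ℤ) ⊆ I →
      EllOneLower 𝕜 (fun i : ℤ => (α ^ i : X ≃ₗᵢ[𝕜] X) x) r J := by
  obtain ⟨γ, hγ⟩ := h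
  have hinj : Function.Injective fun i : ℤ => (α ^ i : X ≃ₗᵢ[𝕜] X) x := by
    refine injective_orbit_of_infinite fun hfin => hI ?_
    exact Set.finite_univ_iff.mp
      (Set.Finite.of_injOn hγ.mapsTo hγ.injOn (hfin.subset (Set.image_subset_range _ I)))
  refine ⟨(‖γ.symm.toContinuousLinearMap‖ + 1)⁻¹, by positivity, fun J hJ c => ?_⟩
  rw [inv_mul_le_iff₀ (by positivity)]
  refine (sum_norm_le_of_mapsBasisOnto hγ ((Set.mapsTo_image _ I).mono_left hJ) hinj.injOn
    c).trans ?_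
  gcongr
  exact (lt_add_one _).le

theorem HasPositiveDensityEllOneSet.hasProportionalLower
    (h : HasPositiveDensityEllOneSet α x) : HasProportionalLower α x := by
  classical
  obtain ⟨I, D, hD, hdens, hI⟩ := h
  obtain ⟨r, hr, hlow⟩ := hI.exists_ellOneLower (hdens.infinite hD)
  have htend : Tendsto (fun n : ℕ => 2 * n + 1) atTop atTop :=
    tendsto_atTop_mono (fun n => show n ≤ 2 * n + 1 by omega) tendsto_id
  refine ⟨r, D / 2, hr, half_pos hD, htend.frequently (Eventually.frequently ?_)⟩
  filter_upwards [hdens.eventually_le_card (half_lt_self hD)] with n hcard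
  refine ⟨_, Finset.filter_subset _ _, hcard, ?_⟩
  let e : ℕ ↪ ℤ := Nat.castEmbedding.trans (Equiv.subRight (n : ℤ)).toEmbedding
  have shifted := EllOneLower.of_map e (hlow (Finset.map e
    {i ∈ Finset.range (2 * n + 1) | (i : ℤ) - n ∈ I}) fun i hi => by
      obtain ⟨j, hj, rfl⟩ := Finset.mem_map.mp (Finset.mem_coe.mp hi)
      exact (Finset.mem_filter.mp hj).2)
  rw [← ellOneLower_comp_linearIsometry (α ^ n : X ≃ₗᵢ[𝕜] X).toLinearIsometry] at shifted
  convert shifted using 2 with i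
  change _ = (α ^ n : X ≃ₗᵢ[𝕜] X) ((α ^ ((i : ℤ) - n) : X ≃ₗᵢ[𝕜] X) x)
  rw [← zpow_natCast α n, ← zpow_add_apply, add_sub_cancel, zpow_natCast]

end Orbit

section Growth

theorem ofReal_le_enatCast_iff {t : ℝ} {a : ℕ∞} :
    ENNReal.ofReal t ≤ a ↔ ∀ m : ℕ, a ≤ m → t ≤ m := by
  cases a with
  | top => simp
  | coe k =>
    simp only [ENat.toENNReal_coe, ENNReal.ofReal_le_natCast, Nat.cast_le]
    exact ⟨fun h m hm => h.trans (Nat.cast_le.mpr hm), fun h => h k le_rfl⟩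

theorem ereal_exp_mul_natCast (b : ℝ) (n : ℕ) :
    EReal.exp (b * n) = ENNReal.ofReal (Real.exp (b * n)) := by
  rw [← EReal.exp_coe]
  norm_cast

variable {u : ℕ → ℕ∞}

theorem coe_le_expGrowthSup_of_frequently {b : ℝ}
    (h : ∃ᶠ n : ℕ in atTop, ∀ m : ℕ, u n ≤ m → Real.exp (b * n) ≤ m) :
    (b : EReal) ≤ ExpGrowth.expGrowthSup fun n => (u n : ENNReal) :=
  Frequently.le_expGrowthSup (h.mono fun n hn => by
    rw [ereal_exp_mul_natCast]
    exact ofReal_le_enatCast_iff.mpr hn)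

theorem exists_frequently_exp_lt_of_expGrowthSup_pos
    (h : 0 < ExpGrowth.expGrowthSup fun n => (u n : ENNReal)) :
    ∃ b : ℝ, 0 < b ∧ ∃ᶠ n : ℕ in atTop, ∀ m : ℕ, u n ≤ m → Real.exp (b * n) < m := by
  obtain ⟨b, hb0, hb⟩ := EReal.exists_between_coe_real h
  have hb0 : 0 < b := EReal.coe_pos.mp hb0
  refine ⟨b / 2, half_pos hb0, ((ExpGrowth.frequently_exp_le hb).and_eventually
    (eventually_gt_atTop 0)).mono fun n ⟨hn, hn0⟩ m hm => ?_⟩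
  rw [ereal_exp_mul_natCast] at hn
  refine lt_of_lt_of_le ?_ (ofReal_le_enatCast_iff.mp hn m hm)
  have : (0 : ℝ) < n := Nat.cast_pos.mpr hn0
  gcongr
  exact half_lt_self hb0

theorem eventually_exp_half_le {c : ℝ} (hc : 0 < c) :
    ∀ᶠ n : ℕ in atTop, Real.exp (c / 2 * n) ≤ Real.exp (c * n) / 4 := by
  have h : Tendsto (fun n : ℕ => Real.exp (c / 2 * n)) atTop atTop :=
    Real.tendsto_exp_atTop.comp (tendsto_natCast_atTop_atTop.const_mul_atTop (half_pos hc))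
  filter_upwards [h.eventually_ge_atTop 4] with n hn
  have exp_eq : Real.exp (c * n) = Real.exp (c / 2 * n) * Real.exp (c / 2 * n) := by
    rw [← Real.exp_add, ← add_mul, add_halves]
  rw [exp_eq, le_div_iff₀ four_pos]
  gcongr

end Growth

section TopologicalEntropy

variable {K : Type*} [TopologicalSpace K]

theorem mem_nhdsSet_diagonal_of_continuous {E : Type*} [SeminormedAddCommGroup E] {f : K → E}
    (hf : Continuous f) {δ : ℝ} (hδ : 0 < δ) :
    {p : K × K | ‖f p.1 - f p.2‖ < δ} ∈ 𝓝ˢ (Set.diagonal K) := by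
  refine (IsOpen.mem_nhdsSet (isOpen_lt (by fun_prop) continuous_const)).mpr ?_
  rintro ⟨p, q⟩ (rfl : p = q)
  simpa using hδ

variable [CompactSpace K] [T2Space K] {T : K → K}

theorem coe_le_htop_of_frequently {U : SetRel K K} (hU : U ∈ 𝓝ˢ (Set.diagonal K)) {b : ℝ}
    (h : ∃ᶠ n : ℕ in atTop, ∀ s : Finset K, Dynamics.IsDynCoverOf T Set.univ U n s →
      Real.exp (b * n) ≤ s.card) : (b : EReal) ≤ htop T := by
  let _ : UniformSpace K := uniformSpaceOfCompactR1
  refine (coe_le_expGrowthSup_of_frequently (h.mono fun n hn m hm => ?_)).trans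
    (Dynamics.coverEntropyEntourage_le_coverEntropy T Set.univ hU)
  have hlt : Dynamics.coverMincard T Set.univ U n < ((m + 1 : ℕ) : ℕ∞) :=
    hm.trans_lt (Nat.cast_lt.mpr (Nat.lt_succ_self m))
  simp only [Dynamics.coverMincard, iInf_lt_iff, Nat.cast_lt] at hlt
  obtain ⟨s, hs, hsm⟩ := hlt
  exact (hn s hs).trans (Nat.cast_le.mpr (Nat.lt_succ_iff.mp hsm))

theorem exists_separated_of_htop_pos (h : 0 < htop T) :
    ∃ U ∈ 𝓝ˢ (Set.diagonal K), ∃ b : ℝ, 0 < b ∧ ∃ᶠ n : ℕ in atTop, ∃ s : Finset K,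
      Real.exp (b * n) < s.card ∧
        (s : Set K).Pairwise fun p q => ∃ i < n, (T^[i] p, T^[i] q) ∉ U := by
  let _ : UniformSpace K := uniformSpaceOfCompactR1
  rw [htop, Dynamics.coverEntropy_eq_iSup_netEntropyEntourage] at h
  simp only [lt_iSup_iff] at h
  obtain ⟨U, hU, hpos⟩ := h
  obtain ⟨b, hb, hfreq⟩ := exists_frequently_exp_lt_of_expGrowthSup_pos hpos
  refine ⟨U, hU, b, hb, hfreq.mono fun n hn => ?_⟩
  obtain ⟨s, hs, hcard⟩ : ∃ s : Finset K, Dynamics.IsDynNetIn T Set.univ U n s ∧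
      Real.exp (b * n) < s.card := by
    by_contra! hsmall
    have hle : Dynamics.netMaxcard T Set.univ U n ≤ (⌊Real.exp (b * n)⌋₊ : ℕ∞) :=
      iSup₂_le fun s hs => Nat.cast_le.mpr (Nat.le_floor (hsmall s hs))
    exact (hn _ hle).not_ge (Nat.floor_le (Real.exp_pos _).le)
  refine ⟨s, hcard, fun p hp q hq hpq => ?_⟩
  by_contra! hclose
  exact Set.disjoint_left.mp (hs.2 hp hq hpq)
    (show q ∈ _ from Dynamics.mem_dynEntourage.mpr hclose)
    (Dynamics.mem_dynEntourage.mpr fun i _ => refl_mem_uniformity hU)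

end TopologicalEntropy

section WeakStarSystems

variable {𝕜 X K : Type*} [RCLike 𝕜] [NormedAddCommGroup X] [NormedSpace 𝕜 X]
  {α : X ≃ₗᵢ[𝕜] X} {T : K → K} {e : K → DualBall 𝕜 X} {Ω : Finset X} {δ : ℝ}

theorem norm_dualBall_apply_le (ω : DualBall 𝕜 X) (x : X) : ‖ω.1 x‖ ≤ ‖x‖ := by
  simpa using (WeakDual.toStrongDual ω.1).le_of_opNorm_le (mem_closedBall_zero_iff.mp ω.2) x

theorem continuous_dualBall_eval (x : X) : Continuous fun ω : DualBall 𝕜 X => ω.1 x :=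
  (WeakDual.eval_continuous x).comp continuous_subtype_val

theorem dualHomeo_iterate_apply (n : ℕ) (ω : DualBall 𝕜 X) (x : X) :
    ((dualHomeo α)^[n] ω).1 x = ω.1 ((α ^ n : X ≃ₗᵢ[𝕜] X) x) := by
  induction n generalizing ω with
  | zero => rfl
  | succ n ih =>
    rw [Function.iterate_succ_apply, ih, pow_succ']
    rfl

theorem apply_iterate_of_semiconj (he : Function.Semiconj e T (dualHomeo α)) (n : ℕ) (p : K)
    (x : X) : (e (T^[n] p)).1 x = (e p).1 ((α ^ n : X ≃ₗᵢ[𝕜] X) x) := by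
  rw [he.iterate_right n p, dualHomeo_iterate_apply]

/-- The basic entourage of the weak* uniformity, pulled back along `e`: two points are close when
their functionals differ by less than `δ` on the finite set `Ω`. -/
def evalEntourage (e : K → DualBall 𝕜 X) (Ω : Finset X) (δ : ℝ) : SetRel K K :=
  {p | ∀ x ∈ Ω, ‖(e p.1).1 x - (e p.2).1 x‖ < δ}

theorem evalEntourage_mem_nhdsSet_diagonal [TopologicalSpace K] (hec : Continuous e)
    (hδ : 0 < δ) : evalEntourage e Ω δ ∈ 𝓝ˢ (Set.diagonal K) :=
  (eventually_all_finset Ω).mpr fun x _ =>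
    mem_nhdsSet_diagonal_of_continuous ((continuous_dualBall_eval x).comp hec) hδ

theorem exists_mem_orbit_close_of_isDynCoverOf (he : Function.Semiconj e T (dualHomeo α))
    {n : ℕ} {s : Set K} (hs : Dynamics.IsDynCoverOf T Set.univ (evalEntourage e Ω δ) n s)
    (p : K) : ∃ t ∈ s, ∀ i < n, ∀ x ∈ Ω,
      ‖(e p).1 ((α ^ i : X ≃ₗᵢ[𝕜] X) x) - (e t).1 ((α ^ i : X ≃ₗᵢ[𝕜] X) x)‖ < δ := by
  obtain ⟨t, ht, hpt⟩ := hs (Set.mem_univ p)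
  refine ⟨t, ht, fun i hi x hx => ?_⟩
  rw [← apply_iterate_of_semiconj he, ← apply_iterate_of_semiconj he]
  exact Dynamics.mem_dynEntourage.mp hpt i hi x hx

end WeakStarSystems

section LowerBounds

variable {𝕜 X Y ι : Type*} [RCLike 𝕜] [NormedAddCommGroup X] [NormedSpace 𝕜 X]
  [NormedAddCommGroup Y] [NormedSpace 𝕜 Y] {α : X ≃ₗᵢ[𝕜] X} {x : X}

theorem norm_sum_units_smul_le_add {E : Type*} [SeminormedAddCommGroup E] {J : Finset ι}
    {a b : ι → E} {δ : ℝ} (σ : ι → ℤˣ) (h : ∀ i ∈ J, ‖a i - b i‖ ≤ δ) :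
    ‖∑ i ∈ J, σ i • a i‖ ≤ ‖∑ i ∈ J, σ i • b i‖ + δ * J.card := by
  refine norm_le_norm_add_const_of_dist_le ?_
  rw [dist_eq_norm, ← Finset.sum_sub_distrib, mul_comm, ← nsmul_eq_mul, ← Finset.sum_const]
  refine norm_sum_le_of_le J fun i hi => ?_
  rw [← smul_sub, norm_units_zsmul]
  exact h i hi

-- The index set `s` is a dynamical cover in the application to `htop`, and the set of coordinates
-- of `ℓ_∞^d` in the application to `hc`.
theorem HasProportionalLower.exists_exp_le_card (h : HasProportionalLower α x) :
    ∃ r : ℝ, 0 < r ∧ ∀ θ : ℝ, 0 < θ → ∃ b : ℝ, 0 < b ∧ ∃ᶠ n : ℕ in atTop,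
      ∃ J ⊆ Finset.range n, J.Nonempty ∧
        EllOneLower 𝕜 (fun i : ℕ => (α ^ i : X ≃ₗᵢ[𝕜] X) x) r J ∧
        ∀ {τ : Type*} (s : Finset τ) (a : τ → ℕ → 𝕜), (∀ t ∈ s, ∀ i ∈ J, ‖a t i‖ ≤ ‖x‖) →
          (∀ σ : ℕ → ℤˣ, ∃ t ∈ s, θ * J.card ≤ ‖∑ i ∈ J, σ i • a t i‖) →
          Real.exp (b * n) ≤ s.card := by
  obtain ⟨r, d, hr, hd, hfreq⟩ := h
  refine ⟨r, hr, fun θ hθ => ?_⟩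
  have nonempty {n : ℕ} {J : Finset ℕ} (hn : 0 < n) (hJ : d * n ≤ J.card) : J.Nonempty :=
    Finset.card_pos.mp (Nat.cast_pos.mp ((mul_pos hd (Nat.cast_pos.mpr hn)).trans_le hJ))
  have hfreq := hfreq.and_eventually (eventually_gt_atTop 0)
  have hx : 0 < ‖x‖ := by
    obtain ⟨n, ⟨J, -, hJ, hlow⟩, hn⟩ := hfreq.exists
    rw [norm_pos_iff]
    rintro rfl
    have := hlow.mul_card_le 1
    simp only [map_zero, smul_zero, Finset.sum_const_zero, norm_zero] at this
    exact this.not_gt (mul_pos hr (Nat.cast_pos.mpr (nonempty hn hJ).card_pos))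
  set b := θ ^ 2 / (8 * ‖x‖ ^ 2) * d
  have hb : 0 < b := by positivity
  refine ⟨b / 2, half_pos hb, (hfreq.and_eventually (eventually_exp_half_le hb)).mono ?_⟩
  rintro n ⟨⟨⟨J, hJn, hJ, hlow⟩, hn⟩, hexp⟩
  refine ⟨J, hJn, nonempty hn hJ, hlow, fun s a ha hsign => hexp.trans ?_⟩
  rw [div_le_iff₀' four_pos]
  refine le_trans ?_ (exp_le_four_mul_card_of_finset_sign_sums J s a hx hθ.le ha hsign)
  rw [mul_assoc]
  gcongr

theorem HasProportionalLower.htop_pos {K : Type*} [TopologicalSpace K] [CompactSpace K] [T2Space K]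
    {T : K → K} {e : K → DualBall 𝕜 X} (hec : Continuous e)
    (he : Function.Semiconj e T (dualHomeo α)) {κ : ℝ} (hκ : 0 < κ)
    (hnorm : ∀ v : X, v ≠ 0 → ∃ p, κ * ‖v‖ ≤ ‖(e p).1 v‖) (h : HasProportionalLower α x) :
    0 < htop T := by
  obtain ⟨r, hr, h⟩ := h.exists_exp_le_card
  have hθ : 0 < κ * r / 2 := by positivity
  obtain ⟨b, hb, hfreq⟩ := h _ hθ
  refine (EReal.coe_pos.mpr hb).trans_le (coe_le_htop_of_frequently
    (evalEntourage_mem_nhdsSet_diagonal (Ω := {x}) hec hθ) (hfreq.mono ?_))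
  rintro n ⟨J, hJn, hJ, hlow, hcard⟩ s hs
  refine hcard s (fun t i => (e t).1 ((α ^ i : X ≃ₗᵢ[𝕜] X) x))
    (fun t _ i _ => (norm_dualBall_apply_le _ _).trans_eq (LinearIsometryEquiv.norm_map _ _))
    fun σ => ?_
  set v := ∑ i ∈ J, σ i • (α ^ i : X ≃ₗᵢ[𝕜] X) x
  have hv : r * J.card ≤ ‖v‖ := hlow.mul_card_le σ
  have hJ0 : (0 : ℝ) < J.card := Nat.cast_pos.mpr hJ.card_pos
  obtain ⟨p, hp⟩ := hnorm v (norm_pos_iff.mp ((mul_pos hr hJ0).trans_le hv))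
  obtain ⟨t, ht, hpt⟩ := exists_mem_orbit_close_of_isDynCoverOf he hs p
  have hclose := norm_sum_units_smul_le_add σ fun i hi =>
    (hpt i (Finset.mem_range.mp (hJn hi)) x (Finset.mem_singleton_self x)).le
  have hpv : (e p).1 v = ∑ i ∈ J, σ i • (e p).1 ((α ^ i : X ≃ₗᵢ[𝕜] X) x) := by
    simp [v, Units.smul_def]
  rw [← hpv] at hclose
  exact ⟨t, ht, by linarith [mul_le_mul_of_nonneg_left hv hκ.le]⟩

theorem IsCA.exists_mul_card_le_norm_sum {γ : X →ₗᵢ[𝕜] Y} {S : Set X} {r : ℝ} {D : ℕ}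
    {φ : X →L[𝕜] (Fin D → 𝕜)} {ψ : (Fin D → 𝕜) →L[𝕜] Y}
    (h : IsCA γ.toContinuousLinearMap S (r / 2) D φ ψ) {y : ι → X} {J : Finset ι}
    (hJS : ∀ i ∈ J, y i ∈ S) (hlow : EllOneLower 𝕜 y r J) (σ : ι → ℤˣ) :
    ∃ t, r / 2 * J.card ≤ ‖∑ i ∈ J, σ i • φ (y i) t‖ := by
  obtain ⟨hD, -, hψ, happrox⟩ := h
  have := Fin.pos_iff_nonempty.mp hD
  set v := ∑ i ∈ J, σ i • y i
  have hclose := norm_sum_units_smul_le_add (J := J) (a := fun i => γ (y i)) σ fun i hi =>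
    (norm_sub_rev _ _).trans_le (happrox (y i) (hJS i hi)).le
  have hγv : ∑ i ∈ J, σ i • γ (y i) = γ v := by
    simp only [v, Units.smul_def, map_sum, map_zsmul]
  have hψv : ∑ i ∈ J, σ i • ψ (φ (y i)) = ψ (φ v) := by
    simp only [v, Units.smul_def, map_sum, map_zsmul]
  rw [hγv, hψv, γ.norm_map] at hclose
  have hφv : r / 2 * J.card ≤ ‖φ v‖ := by
    linarith [hlow.mul_card_le σ, (ψ.le_of_opNorm_le hψ (φ v)).trans_eq (one_mul _)]
  obtain ⟨t, ht⟩ := Finite.exists_max fun t => ‖φ v t‖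
  refine ⟨t, hφv.trans (((pi_norm_le_iff_of_nonempty _).mpr ht).trans_eq ?_)⟩
  simp [v, Units.smul_def]

theorem exists_isCA_of_rc_le {γ : X →ₗᵢ[𝕜] Y} {S : Set X} {δ : ℝ} {m : ℕ} (h : rc γ S δ ≤ m) :
    ∃ D ≤ m, ∃ φ ψ, IsCA γ.toContinuousLinearMap S δ D φ ψ := by
  have hlt : rc γ S δ < (m + 1 : ℕ) := h.trans_lt (Nat.cast_lt.mpr m.lt_succ_self)
  obtain ⟨_, ⟨D, φ, ψ, hca, rfl⟩, hD⟩ := sInf_lt_iff.mp hlt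
  exact ⟨D, Nat.lt_succ_iff.mp (Nat.cast_lt.mp hD), φ, ψ, hca⟩

theorem HasProportionalLower.hc_pos (γ : X →ₗᵢ[𝕜] Y) (h : HasProportionalLower α x) :
    0 < hc γ α := by
  obtain ⟨r, hr, h⟩ := h.exists_exp_le_card
  obtain ⟨b, hb, hfreq⟩ := h _ (half_pos hr)
  suffices hbound : (b : EReal) ≤ hcAt γ α {x} (r / 2) from
    (EReal.coe_pos.mpr hb).trans_le
      (hbound.trans (le_iSup_of_le {x} (le_iSup₂_of_le (r / 2) (half_pos hr) le_rfl)))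
  refine coe_le_expGrowthSup_of_frequently
    (u := fun n => rc γ (orbitUnion α {x} n) (r / 2)) (hfreq.mono ?_)
  rintro n ⟨J, hJn, -, hlow, hcard⟩ m hm
  obtain ⟨D, hDm, φ, ψ, hca⟩ := exists_isCA_of_rc_le hm
  have hexp := hcard (Finset.univ : Finset (Fin D)) (fun t i => φ ((α ^ i : X ≃ₗᵢ[𝕜] X) x) t)
    (fun t _ i _ => ?_) fun σ => ?_
  · exact hexp.trans (by simpa using hDm)
  · refine (norm_le_pi_norm _ t).trans ((φ.le_of_opNorm_le hca.2.1 _).trans_eq ?_)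
    rw [one_mul, LinearIsometryEquiv.norm_map]
  · obtain ⟨t, ht⟩ := hca.exists_mul_card_le_norm_sum
      (fun i hi => Set.mem_biUnion (hJn hi) ⟨x, by simp, rfl⟩) hlow σ
    exact ⟨t, Finset.mem_univ t, ht⟩

end LowerBounds

section Interpolation

variable {𝕜 X ι : Type*} [RCLike 𝕜] [NormedAddCommGroup X] [NormedSpace 𝕜 X] {r : ℝ}

theorem EllOneLower.subtype {y : ι → X} {J : Finset ι} (h : EllOneLower 𝕜 y r J) :
    EllOneLower 𝕜 (fun i : J => y i) r Finset.univ :=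
  .of_map (Function.Embedding.subtype _) (h.mono (Finset.attach_map_val (s := J)).le)

variable [Fintype ι] {y : ι → X}

theorem EllOneLower.linearCombination_injective (hr : 0 < r)
    (h : EllOneLower 𝕜 y r Finset.univ) :
    Function.Injective (Fintype.linearCombination 𝕜 y) := by
  refine (injective_iff_map_eq_zero _).mpr fun c hc => funext fun i => norm_le_zero_iff.mp ?_
  have hsum := h c
  rw [← Fintype.linearCombination_apply, hc, norm_zero] at hsum
  exact (Finset.single_le_sum (fun j _ => norm_nonneg (c j)) (Finset.mem_univ i)).trans
    (nonpos_of_mul_nonpos_right hsum hr)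

theorem EllOneLower.norm_linearCombination_le (h : EllOneLower 𝕜 y r Finset.univ) {v : ι → 𝕜}
    (hv : ∀ i, ‖v i‖ ≤ r) (c : ι → 𝕜) :
    ‖Fintype.linearCombination 𝕜 v c‖ ≤ ‖Fintype.linearCombination 𝕜 y c‖ := by
  simp only [Fintype.linearCombination_apply]
  refine le_trans ?_ (h c)
  rw [Finset.mul_sum]
  refine norm_sum_le_of_le _ fun i _ => ?_
  rw [norm_smul, mul_comm]
  gcongr
  exact hv i

theorem EllOneLower.exists_dualBall (hr : 0 < r) (h : EllOneLower 𝕜 y r Finset.univ)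
    {v : ι → 𝕜} (hv : ∀ i, ‖v i‖ ≤ r) : ∃ ω : DualBall 𝕜 X, ∀ i, ω.1 (y i) = v i := by
  classical
  let E := LinearEquiv.ofInjective _ (h.linearCombination_injective hr)
  let f : LinearMap.range (Fintype.linearCombination 𝕜 y) →ₗ[𝕜] 𝕜 :=
    Fintype.linearCombination 𝕜 v ∘ₗ E.symm.toLinearMap
  have hf (u) : ‖f u‖ ≤ 1 * ‖u‖ := by
    obtain ⟨c, rfl⟩ := E.surjective u
    simpa [f, E] using h.norm_linearCombination_le hv c
  obtain ⟨g, hgf, hg⟩ := exists_extension_norm_eq _ (f.mkContinuous 1 hf)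
  refine ⟨⟨StrongDual.toWeakDual g, mem_closedBall_zero_iff.mpr
    (hg.trans_le (f.mkContinuous_norm_le zero_le_one hf))⟩, fun i => ?_⟩
  have hi : y i = E (Pi.single i 1) := by simp [E]
  change g (y i) = v i
  rw [hi, hgf]
  simp [f]

theorem eq_of_norm_ofReal_mul_natCast_sub_lt {c : ℝ} (hc : 0 < c) {m k : ℕ}
    (h : ‖((c * m : ℝ) : 𝕜) - ((c * k : ℝ) : 𝕜)‖ < c) : m = k := by
  rw [← RCLike.ofReal_sub, RCLike.norm_ofReal, ← mul_sub, abs_mul, abs_of_pos hc,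
    mul_lt_iff_lt_one_right hc] at h
  have habs : |(m : ℤ) - (k : ℤ)| < 1 := by exact_mod_cast h
  rw [Int.abs_lt_one_iff, sub_eq_zero] at habs
  exact Nat.cast_injective habs

theorem EllOneLower.pow_card_le_card (hr : 0 < r) (h : EllOneLower 𝕜 y r Finset.univ) {M : ℕ}
    (hM : 0 < M) (s : Finset (DualBall 𝕜 X))
    (hs : ∀ ω : DualBall 𝕜 X, ∃ t ∈ s, ∀ i, ‖ω.1 (y i) - t.1 (y i)‖ < r / M / 2) :
    M ^ Fintype.card ι ≤ s.card := by
  classical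
  have hc : 0 < r / M := by positivity
  have interpolate (k : ι → Fin M) :
      ∃ ω : DualBall 𝕜 X, ∀ i, ω.1 (y i) = ((r / M * (k i : ℕ) : ℝ) : 𝕜) := by
    refine h.exists_dualBall hr fun i => ?_
    rw [RCLike.norm_ofReal, abs_of_nonneg (by positivity), div_mul_eq_mul_div]
    exact div_le_of_le_mul₀ (by positivity) hr.le (by gcongr; exact (k i).2.le)
  choose ω hω using interpolate
  choose t ht hωt using fun k => hs (ω k)
  have t_injective : Function.Injective t := fun k k' hkk' => funext fun i => by
    refine Fin.ext (eq_of_norm_ofReal_mul_natCast_sub_lt (𝕜 := 𝕜) hc ?_)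
    have hk := hωt k i
    have hk' := hωt k' i
    rw [← hkk', norm_sub_rev] at hk'
    rw [← hω, ← hω, ← add_halves (r / M)]
    exact (norm_sub_le_norm_sub_add_norm_sub _ _ _).trans_lt (add_lt_add hk hk')
  simpa using Finset.card_le_card_of_injOn (s := Finset.univ) t (fun k _ => ht k)
    t_injective.injOn

theorem HasProportionalLower.htop_eq_top {α : X ≃ₗᵢ[𝕜] X} {x : X}
    (h : HasProportionalLower α x) : htop (dualHomeo (𝕜 := 𝕜) α) = ⊤ := by
  obtain ⟨r, d, hr, hd, hfreq⟩ := h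
  suffices hle : ∀ b : ℝ, (b : EReal) ≤ htop (dualHomeo (𝕜 := 𝕜) α) from
    (EReal.eq_top_iff_forall_lt _).mpr fun b =>
      (EReal.coe_lt_coe_iff.mpr (lt_add_one b)).trans_le (hle (b + 1))
  intro b
  obtain ⟨M, hM⟩ := exists_nat_gt (Real.exp (|b| / d))
  have hM0 : (0 : ℝ) < M := (Real.exp_pos _).trans hM
  have hlog : |b| / d < Real.log M := (Real.lt_log_iff_exp_lt hM0).mpr hM
  have hlog0 : 0 ≤ Real.log M := le_trans (by positivity) hlog.le
  refine coe_le_htop_of_frequently (evalEntourage_mem_nhdsSet_diagonal (e := id) (Ω := {x})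
    (δ := r / M / 2) continuous_id (by positivity)) (hfreq.mono ?_)
  rintro n ⟨J, hJn, hJ, hlow⟩ s hs
  have hcard : M ^ J.card ≤ s.card := by
    rw [← Fintype.card_coe J]
    refine hlow.subtype.pow_card_le_card hr (Nat.cast_pos.mp hM0) s fun ω => ?_
    obtain ⟨t, ht, hωt⟩ := exists_mem_orbit_close_of_isDynCoverOf .id_left hs ω
    exact ⟨t, ht, fun i => hωt i (Finset.mem_range.mp (hJn i.2)) x (Finset.mem_singleton_self x)⟩
  calc Real.exp (b * n) ≤ Real.exp (J.card * Real.log M) := by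
        refine Real.exp_le_exp.mpr ?_
        calc b * n ≤ Real.log M * d * n := by
              gcongr
              exact (le_abs_self b).trans ((div_le_iff₀ hd).mp hlog.le)
          _ = d * n * Real.log M := by ring
          _ ≤ J.card * Real.log M := mul_le_mul_of_nonneg_right hJ hlog0
    _ = (M : ℝ) ^ J.card := by rw [Real.exp_nat_mul, Real.exp_log hM0]
    _ ≤ s.card := by exact_mod_cast hcard

end Interpolation

section UpperBound

variable {𝕜 X Y : Type*} [RCLike 𝕜] [NormedAddCommGroup X] [NormedSpace 𝕜 X]
  [NormedAddCommGroup Y] [NormedSpace 𝕜 Y]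

theorem norm_continuousLinearMap_pi_le {ι : Type*} [Fintype ι] {C : ℝ} (hC : 0 ≤ C)
    {f : ι → X →L[𝕜] Y} (hf : ∀ i, ‖f i‖ ≤ C) : ‖ContinuousLinearMap.pi f‖ ≤ C :=
  ContinuousLinearMap.opNorm_le_bound _ hC fun x =>
    (pi_norm_le_iff_of_nonneg (by positivity)).mpr fun i => (f i).le_of_opNorm_le (hf i) x

theorem norm_continuousLinearMap_proj_le {ι : Type*} [Fintype ι] (i : ι) :
    ‖(ContinuousLinearMap.proj i : (ι → Y) →L[𝕜] Y)‖ ≤ 1 :=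
  ContinuousLinearMap.opNorm_le_bound _ zero_le_one fun v =>
    (norm_le_pi_norm v i).trans_eq (one_mul _).symm

/-- The `j`-th coordinate functional of a contraction into `ℓ_∞^d`, as a point of the dual ball. -/
def coordDualBall {d : ℕ} (φ : X →L[𝕜] (Fin d → 𝕜)) (hφ : ‖φ‖ ≤ 1) (j : Fin d) :
    DualBall 𝕜 X :=
  ⟨StrongDual.toWeakDual ((ContinuousLinearMap.proj j).comp φ), mem_closedBall_zero_iff.mpr
    ((ContinuousLinearMap.opNorm_comp_le _ _).trans
      (mul_le_one₀ (norm_continuousLinearMap_proj_le j) (norm_nonneg φ) hφ))⟩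

theorem IsCA.of_norm_sub_le {γ : X →L[𝕜] Y} {Ω : Set X} {δ δ' : ℝ} {d d' : ℕ}
    {φ : X →L[𝕜] (Fin d → 𝕜)} {ψ : (Fin d → 𝕜) →L[𝕜] Y} (h : IsCA γ Ω δ d φ ψ)
    {φ' : X →L[𝕜] (Fin d' → 𝕜)} {ρ : (Fin d' → 𝕜) →L[𝕜] (Fin d → 𝕜)} (hd' : 0 < d')
    (hφ' : ‖φ'‖ ≤ 1) (hρ : ‖ρ‖ ≤ 1) (hclose : ∀ x ∈ Ω, ‖ρ (φ' x) - φ x‖ ≤ δ') :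
    IsCA γ Ω (δ' + δ) d' φ' (ψ.comp ρ) := by
  obtain ⟨-, -, hψ, happrox⟩ := h
  refine ⟨hd', hφ', (ψ.opNorm_comp_le ρ).trans (mul_le_one₀ hψ (norm_nonneg ρ) hρ),
    fun x hx => ?_⟩
  have hψclose : ‖ψ (ρ (φ' x)) - ψ (φ x)‖ ≤ δ' := by
    rw [← map_sub]
    exact ((ψ.le_of_opNorm_le hψ _).trans_eq (one_mul _)).trans (hclose x hx)
  exact (norm_sub_le_norm_sub_add_norm_sub _ (ψ (φ x)) _).trans_lt
    (add_lt_add_of_le_of_lt hψclose (happrox x hx))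

-- A contraction `φ` into `ℓ_∞^d` is replaced by evaluation at the points of `s`, followed by the
-- contraction that copies, for each coordinate of `φ`, the value at a nearby point of `s`.
theorem rc_le_card {ι : X →ₗᵢ[𝕜] Y} (hι : IsCAEmbedding ι) {Ω : Set X} (hΩ : Ω.Finite) {δ : ℝ}
    (hδ : 0 < δ) (s : Finset (DualBall 𝕜 X))
    (hs : ∀ ω : DualBall 𝕜 X, ∃ t ∈ s, ∀ x ∈ Ω, ‖ω.1 x - t.1 x‖ < δ / 2) :
    rc ι Ω δ ≤ s.card := by
  obtain ⟨d, φ, ψ, hca⟩ := hι hΩ.toFinset (δ / 2) (half_pos hδ)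
  rw [hΩ.coe_toFinset] at hca
  have ⟨hd, hφ, _⟩ := hca
  choose t hts ht using fun j => hs (coordDualBall φ hφ j)
  let f := s.equivFin
  let Φ : X →L[𝕜] (Fin s.card → 𝕜) :=
    ContinuousLinearMap.pi fun k => WeakDual.toStrongDual (f.symm k).1.1
  let ρ : (Fin s.card → 𝕜) →L[𝕜] (Fin d → 𝕜) :=
    ContinuousLinearMap.pi fun j => ContinuousLinearMap.proj (f ⟨t j, hts j⟩)
  have hρΦ : ∀ x j, ρ (Φ x) j = (t j).1 x := fun x j => by
    change (f.symm (f ⟨t j, hts j⟩)).1.1 x = (t j).1 x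
    rw [f.symm_apply_apply]
  refine sInf_le ⟨s.card, Φ, ψ.comp ρ, ?_, rfl⟩
  rw [← add_halves δ]
  refine hca.of_norm_sub_le (Finset.card_pos.mpr ⟨t ⟨0, hd⟩, hts _⟩)
    (norm_continuousLinearMap_pi_le zero_le_one fun k => mem_closedBall_zero_iff.mp (f.symm k).1.2)
    (norm_continuousLinearMap_pi_le zero_le_one fun j => norm_continuousLinearMap_proj_le _)
    fun x hx => (pi_norm_le_iff_of_nonneg (half_pos hδ).le).mpr fun j => ?_
  rw [Pi.sub_apply, hρΦ, norm_sub_rev]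
  exact (ht j x hx).le

theorem hc_le_htop {ι : X →ₗᵢ[𝕜] Y} (hι : IsCAEmbedding ι) (α : X ≃ₗᵢ[𝕜] X) :
    hc ι α ≤ htop (dualHomeo (𝕜 := 𝕜) α) := by
  let _ : UniformSpace (DualBall 𝕜 X) := uniformSpaceOfCompactR1
  refine iSup_le fun Ω => iSup₂_le fun δ hδ => ?_
  have hU : evalEntourage id Ω (δ / 2) ∈ uniformity (DualBall 𝕜 X) := by
    rw [← nhdsSet_diagonal_eq_uniformity]
    exact evalEntourage_mem_nhdsSet_diagonal continuous_id (half_pos hδ)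
  refine le_trans ?_ (Dynamics.coverEntropyEntourage_le_coverEntropy _ Set.univ hU)
  refine ExpGrowth.expGrowthSup_monotone fun n => ENat.toENNReal_le.mpr (le_iInf₂ fun s hs => ?_)
  have finite_orbit : (orbitUnion α Ω n).Finite :=
    (Finset.range n).finite_toSet.biUnion fun i _ => Ω.finite_toSet.image _
  refine rc_le_card hι finite_orbit hδ s fun ω => ?_
  obtain ⟨t, hts, ht⟩ := exists_mem_orbit_close_of_isDynCoverOf .id_left hs ω
  refine ⟨t, hts, fun x hx => ?_⟩
  obtain ⟨i, hi, v, hv, rfl⟩ := Set.mem_iUnion₂.mp hx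
  exact ht i (Finset.mem_range.mp hi) v hv

end UpperBound

section Independence

variable {𝕜 X : Type*} [RCLike 𝕜] [NormedAddCommGroup X] [NormedSpace 𝕜 X] {ι : Type*}

theorem exists_signs_sum_abs_le {E : Type*} [SeminormedAddCommGroup E] {f : E →+ ℝ}
    (hf : ∀ v, f v ≤ ‖v‖) (J : Finset ι) (c : ι → E) :
    ∃ σ : ι → ℤˣ, ∑ i ∈ J, |f (c i)| ≤ ‖∑ i ∈ J, σ i • c i‖ := by
  have exists_sign : ∀ t : ℝ, ∃ u : ℤˣ, u • t = |t| := fun t =>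
    (abs_choice t).elim (fun h => ⟨1, by rw [one_smul, h]⟩) fun h => ⟨-1, by rw [h]; simp⟩
  choose σ hσ using fun i => exists_sign (f (c i))
  refine ⟨σ, le_of_eq_of_le ?_ (hf _)⟩
  simp only [map_sum, Units.smul_def, map_zsmul, ← hσ]

theorem exists_signs_half_sum_norm_le (J : Finset ι) (c : ι → 𝕜) :
    ∃ σ : ι → ℤˣ, (∑ i ∈ J, ‖c i‖) / 2 ≤ ‖∑ i ∈ J, σ i • c i‖ := by
  have hsum : ∑ i ∈ J, ‖c i‖ ≤ ∑ i ∈ J, |RCLike.re (c i)| + ∑ i ∈ J, |RCLike.im (c i)| := by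
    rw [← Finset.sum_add_distrib]
    exact Finset.sum_le_sum fun i _ => norm_le_abs_re_add_abs_im (c i)
  obtain ⟨σ, hσ⟩ := exists_signs_sum_abs_le (f := RCLike.re) RCLike.re_le_norm J c
  obtain ⟨τ, hτ⟩ := exists_signs_sum_abs_le (f := RCLike.im) RCLike.im_le_norm J c
  rcases le_total (∑ i ∈ J, |RCLike.im (c i)|) (∑ i ∈ J, |RCLike.re (c i)|) with h | h
  · exact ⟨σ, by linarith⟩
  · exact ⟨τ, by linarith⟩

-- Choose signs `σ` with `|∑ σᵢ cᵢ|` at least half of `∑ |cᵢ|`, and let `p` and `q` be functionals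
-- realizing `σ` and `-σ`: then `(p - q) (∑ cᵢ yᵢ)` is close to `(z 1 - z (-1)) * ∑ σᵢ cᵢ`.
theorem ellOneLower_of_independent {J : Finset ι} {y : ι → X} {z : ℤˣ → 𝕜} {η : ℝ}
    (hz : 8 * η ≤ ‖z 1 - z (-1)‖)
    (h : ∀ σ : ι → ℤˣ, ∃ ω : DualBall 𝕜 X, ∀ i ∈ J, ‖ω.1 (y i) - z (σ i)‖ < η) :
    EllOneLower 𝕜 y η J := by
  intro c
  obtain ⟨σ, hσ⟩ := exists_signs_half_sum_norm_le J c
  obtain ⟨p, hp⟩ := h σ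
  obtain ⟨q, hq⟩ := h (-σ)
  set v := ∑ i ∈ J, c i • y i with hv
  have sub_eq_smul : ∀ u : ℤˣ, z u - z (-u) = u • (z 1 - z (-1)) := fun u => by
    rcases Int.units_eq_one_or u with rfl | rfl <;> simp
  have hmain : (z 1 - z (-1)) * ∑ i ∈ J, σ i • c i = ∑ i ∈ J, c i * (z (σ i) - z (-σ i)) := by
    rw [Finset.mul_sum]
    refine Finset.sum_congr rfl fun i _ => ?_
    rw [sub_eq_smul (σ i), mul_smul_comm, mul_smul_comm, mul_comm]
  have hpq : p.1 v - q.1 v = ∑ i ∈ J, c i * (p.1 (y i) - q.1 (y i)) := by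
    simp only [hv, map_sum, map_smul, smul_eq_mul, ← Finset.sum_sub_distrib, mul_sub]
  have hdist : ‖(z 1 - z (-1)) * ∑ i ∈ J, σ i • c i‖ ≤
      ‖p.1 v - q.1 v‖ + (∑ i ∈ J, ‖c i‖) * (2 * η) := by
    refine norm_le_norm_add_const_of_dist_le ?_
    rw [hmain, hpq, dist_eq_norm_sub', ← Finset.sum_sub_distrib, Finset.sum_mul]
    refine norm_sum_le_of_le J fun i hi => ?_
    rw [← mul_sub, norm_mul, sub_sub_sub_comm]
    gcongr
    exact (norm_sub_le _ _).trans
      ((add_le_add (hp i hi).le (hq i hi).le).trans_eq (two_mul η).symm)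
  have hfar : 8 * η * ((∑ i ∈ J, ‖c i‖) / 2) ≤ ‖(z 1 - z (-1)) * ∑ i ∈ J, σ i • c i‖ := by
    rw [norm_mul]
    gcongr
  have hclose : ‖p.1 v - q.1 v‖ ≤ ‖v‖ + ‖v‖ :=
    (norm_sub_le _ _).trans (add_le_add (norm_dualBall_apply_le p v) (norm_dualBall_apply_le q v))
  linarith

end Independence

section TotalSets

variable {𝕜 X K : Type*} [RCLike 𝕜] [NormedAddCommGroup X] [NormedSpace 𝕜 X] {Δ : Set X}

theorem exists_mem_apply_ne (hΔ : (Submodule.span 𝕜 Δ).topologicalClosure = ⊤)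
    {ω ω' : DualBall 𝕜 X} (h : ω ≠ ω') : ∃ x ∈ Δ, ω.1 x ≠ ω'.1 x := by
  by_contra! heq
  exact h (Subtype.ext (WeakDual.toStrongDual.injective (ContinuousLinearMap.ext_on
    (Submodule.dense_iff_topologicalClosure_eq_top.mpr hΔ) heq)))

theorem exists_evalEntourage_subset [TopologicalSpace K] [CompactSpace K] {e : K → DualBall 𝕜 X}
    (hec : Continuous e) (hei : Function.Injective e)
    (hΔ : (Submodule.span 𝕜 Δ).topologicalClosure = ⊤) {U : SetRel K K}
    (hU : U ∈ 𝓝ˢ (Set.diagonal K)) :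
    ∃ Ω : Finset X, (Ω : Set X) ⊆ Δ ∧ ∃ δ : ℝ, 0 < δ ∧ evalEntourage e Ω δ ⊆ U := by
  classical
  obtain ⟨V, hVo, hdV, hVU⟩ := mem_nhdsSet_iff_exists.mp hU
  suffices ∃ Ω : Finset X, (Ω : Set X) ⊆ Δ ∧ ∃ δ : ℝ, 0 < δ ∧ Vᶜ ⊆ (evalEntourage e Ω δ)ᶜ by
    obtain ⟨Ω, hΩ, δ, hδ, h⟩ := this
    exact ⟨Ω, hΩ, δ, hδ, (Set.compl_subset_compl.mp h).trans hVU⟩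
  have anti : ∀ {Ω Ω' : Finset X} {δ δ' : ℝ}, Ω ⊆ Ω' → δ' ≤ δ →
      (evalEntourage e Ω δ)ᶜ ⊆ (evalEntourage e Ω' δ')ᶜ := fun hΩ hδ =>
    Set.compl_subset_compl.mpr fun _ h x hx => (h x (hΩ hx)).trans_le hδ
  refine hVo.isClosed_compl.isCompact.induction_on
    (p := fun S => ∃ Ω : Finset X, (Ω : Set X) ⊆ Δ ∧ ∃ δ : ℝ, 0 < δ ∧ S ⊆ (evalEntourage e Ω δ)ᶜ)
    ⟨∅, by simp, 1, one_pos, Set.empty_subset _⟩ ?_ ?_ ?_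
  · rintro S S' hSS' ⟨Ω, hΩ, δ, hδ, h⟩
    exact ⟨Ω, hΩ, δ, hδ, hSS'.trans h⟩
  · rintro S S' ⟨Ω, hΩ, δ, hδ, h⟩ ⟨Ω', hΩ', δ', hδ', h'⟩
    exact ⟨Ω ∪ Ω', by simp [hΩ, hΩ'], min δ δ', lt_min hδ hδ', Set.union_subset
      (h.trans (anti Finset.subset_union_left (min_le_left δ δ')))
      (h'.trans (anti Finset.subset_union_right (min_le_right δ δ')))⟩
  · rintro ⟨p, q⟩ hpq
    obtain ⟨x, hx, hne⟩ := exists_mem_apply_ne hΔ (hei.ne fun h : p = q => hpq (hdV h))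
    set t := ‖(e p).1 x - (e q).1 x‖
    have ht : 0 < t := norm_sub_pos_iff.mpr hne
    have hcont : Continuous fun r : K × K => ‖(e r.1).1 x - (e r.2).1 x‖ := by
      have := (continuous_dualBall_eval x).comp hec
      exact ((this.comp continuous_fst).sub (this.comp continuous_snd)).norm
    refine ⟨_, mem_nhdsWithin_of_mem_nhds
        ((isOpen_lt continuous_const hcont).mem_nhds (half_lt_self ht)),
      {x}, by simpa using hx, t / 2, half_pos ht, fun r hr hclose => ?_⟩
    exact lt_asymm hr (hclose x (Finset.mem_singleton_self x))

end TotalSets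

section PositiveEntropy

variable {𝕜 X K : Type*} [RCLike 𝕜] [NormedAddCommGroup X] [NormedSpace 𝕜 X]
  {α : X ≃ₗᵢ[𝕜] X} {e : K → DualBall 𝕜 X} {Ω : Finset X} {η : ℝ}

theorem exists_finset_norm_sub_lt {E : Type*} [SeminormedAddCommGroup E] [ProperSpace E] (R : ℝ)
    (hη : 0 < η) : ∃ N : Finset E, ∀ z : E, ‖z‖ ≤ R → ∃ a ∈ N, ‖z - a‖ < η := by
  obtain ⟨t, ht, hcov⟩ := Metric.totallyBounded_iff.mp
    (isCompact_closedBall (0 : E) R).totallyBounded η hη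
  refine ⟨ht.toFinset, fun z hz => ?_⟩
  obtain ⟨a, ha, hza⟩ := Set.mem_iUnion₂.mp (hcov (mem_closedBall_zero_iff.mpr hz))
  exact ⟨a, ht.mem_toFinset.mpr ha, mem_ball_iff_norm.mp hza⟩

theorem exists_finset_value_pairs (𝕜 : Type*) [RCLike 𝕜] (Ω : Finset X) (hη : 0 < η) :
    ∃ Q : Finset (X × (ℤˣ → 𝕜)), (∀ q ∈ Q, q.1 ∈ Ω ∧ 8 * η ≤ ‖q.2 1 - q.2 (-1)‖) ∧
      ∀ x ∈ Ω, ∀ z : ℤˣ → 𝕜, (∀ u, ‖z u‖ ≤ ‖x‖) → 10 * η ≤ ‖z 1 - z (-1)‖ →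
        ∃ a, (x, a) ∈ Q ∧ ∀ u, ‖z u - a u‖ < η := by
  classical
  obtain ⟨N, hN⟩ := exists_finset_norm_sub_lt (E := 𝕜) (∑ x ∈ Ω, ‖x‖) hη
  refine ⟨(Ω ×ˢ Fintype.piFinset fun _ => N).filter fun q => 8 * η ≤ ‖q.2 1 - q.2 (-1)‖,
    fun q hq => ?_, fun x hx z hz hfar => ?_⟩
  · simp only [Finset.mem_filter, Finset.mem_product] at hq
    exact ⟨hq.1.1, hq.2⟩
  · choose a ha hza using fun u => hN (z u)
      ((hz u).trans (Finset.single_le_sum (f := norm) (fun _ _ => norm_nonneg _) hx))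
    refine ⟨a, ?_, hza⟩
    have hclose : ‖(z 1 - z (-1)) - (a 1 - a (-1))‖ ≤ 2 * η := by
      rw [sub_sub_sub_comm, two_mul]
      exact (norm_sub_le _ _).trans (add_le_add (hza 1).le (hza (-1)).le)
    simp only [Finset.mem_filter, Finset.mem_product, Fintype.mem_piFinset]
    exact ⟨⟨hx, ha⟩, by linarith [norm_sub_norm_le (z 1 - z (-1)) (a 1 - a (-1))]⟩

/-- For an index `(i, x, a)`, the set of points whose functional takes a value within `η` of `a u`
at `α^i x`. For each index these are two sets, one for each sign `u`, as needed for shattering. -/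
def nearValue (α : X ≃ₗᵢ[𝕜] X) (e : K → DualBall 𝕜 X) (η : ℝ) (j : ℕ × X × (ℤˣ → 𝕜)) (u : ℤˣ) :
    Set K :=
  {p | ‖(e p).1 ((α ^ j.1 : X ≃ₗᵢ[𝕜] X) j.2.1) - j.2.2 u‖ < η}

theorem disjoint_nearValue {j : ℕ × X × (ℤˣ → 𝕜)} (hη : 0 < η)
    (hj : 8 * η ≤ ‖j.2.2 1 - j.2.2 (-1)‖) (u : ℤˣ) :
    Disjoint (nearValue α e η j u) (nearValue α e η j (-u)) := by
  wlog hu : u = 1 generalizing u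
  · obtain rfl : u = -1 := (Int.units_eq_one_or u).resolve_left hu
    rw [neg_neg]
    exact (this 1 rfl).symm
  rw [hu, Set.disjoint_left]
  intro p (hp : ‖_ - _‖ < η) (hp' : ‖_ - _‖ < η)
  have := norm_sub_le_norm_sub_add_norm_sub (j.2.2 1)
    ((e p).1 ((α ^ j.1 : X ≃ₗᵢ[𝕜] X) j.2.1)) (j.2.2 (-1))
  rw [norm_sub_rev] at hp
  linarith

theorem pairsSeparate_nearValue {T : K → K} (he : Function.Semiconj e T (dualHomeo α))
    {Q : Finset (X × (ℤˣ → 𝕜))}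
    (hQ : ∀ x ∈ Ω, ∀ z : ℤˣ → 𝕜, (∀ u, ‖z u‖ ≤ ‖x‖) → 10 * η ≤ ‖z 1 - z (-1)‖ →
      ∃ a, (x, a) ∈ Q ∧ ∀ u, ‖z u - a u‖ < η) {n : ℕ} {s : Set K}
    (hs : s.Pairwise fun p q => ∃ i < n, (T^[i] p, T^[i] q) ∉ evalEntourage e Ω (10 * η)) :
    PairsSeparate (nearValue α e η) (Finset.range n ×ˢ Q) s := by
  intro p hp q hq hpq
  obtain ⟨i, hi, hfar⟩ := hs hp hq hpq
  simp only [evalEntourage, Set.mem_ofPred_eq, not_forall, not_lt, exists_prop,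
    apply_iterate_of_semiconj he] at hfar
  obtain ⟨x, hx, hfar⟩ := hfar
  obtain ⟨a, ha, hclose⟩ := hQ x hx
    (fun u => (e (if u = 1 then p else q)).1 ((α ^ i : X ≃ₗᵢ[𝕜] X) x))
    (fun u => (norm_dualBall_apply_le _ _).trans_eq (LinearIsometryEquiv.norm_map _ x))
    (by simpa using hfar)
  exact ⟨(i, x, a), Finset.mk_mem_product (Finset.mem_range.mpr hi) ha, 1,
    by simpa [nearValue] using hclose 1, by simpa [nearValue] using hclose (-1)⟩

theorem ShattersPairs.ellOneLower {S : Set K} {J : Finset (ℕ × X × (ℤˣ → 𝕜))}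
    (h : ShattersPairs (nearValue α e η) S J) {J' : Finset ℕ} {q : X × (ℤˣ → 𝕜)}
    (hJ' : ∀ i ∈ J', (i, q) ∈ J) (hq : 8 * η ≤ ‖q.2 1 - q.2 (-1)‖) :
    EllOneLower 𝕜 (fun i : ℕ => (α ^ i : X ≃ₗᵢ[𝕜] X) q.1) η J' :=
  ellOneLower_of_independent hq fun σ =>
    let ⟨p, _, hp⟩ := h fun j => σ j.1
    ⟨e p, fun i hi => hp (i, q) (hJ' i hi)⟩

theorem exists_large_fiber {κ τ : Type*} {R : Finset κ} {Q : Finset τ} {J : Finset (κ × τ)}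
    (hJ : J ⊆ R ×ˢ Q) (hQ : Q.Nonempty) {c : ℝ} (hc : c * (R ×ˢ Q).card ≤ J.card) :
    ∃ q ∈ Q, ∃ J' ⊆ R, c * R.card ≤ J'.card ∧ ∀ i ∈ J', (i, q) ∈ J := by
  classical
  have hcard : J.card = ∑ q ∈ Q, (R.filter fun i => (i, q) ∈ J).card := by
    calc J.card = ((R ×ˢ Q).filter (· ∈ J)).card := by
          rw [Finset.filter_mem_eq_inter, Finset.inter_eq_right.mpr hJ]
      _ = ∑ q ∈ Q, (R.filter fun i => (i, q) ∈ J).card := by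
          simp only [Finset.card_filter, Finset.sum_product_right]
  obtain ⟨q, hq, hle⟩ : ∃ q ∈ Q, c * R.card ≤ ((R.filter fun i => (i, q) ∈ J).card : ℝ) := by
    refine Finset.exists_le_of_sum_le hQ ?_
    rw [Finset.sum_const, nsmul_eq_mul, ← Nat.cast_sum, ← hcard]
    rw [Finset.card_product, Nat.cast_mul] at hc
    linarith
  exact ⟨q, hq, _, Finset.filter_subset _ R, hle, fun i hi => (Finset.mem_filter.mp hi).2⟩

theorem exists_hasProportionalLower_of_htop_pos [TopologicalSpace K] [CompactSpace K] [T2Space K]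
    {T : K → K} (hec : Continuous e) (hei : Function.Injective e)
    (he : Function.Semiconj e T (dualHomeo α)) {Δ : Set X}
    (hΔ : (Submodule.span 𝕜 Δ).topologicalClosure = ⊤) (h : 0 < htop T) :
    ∃ x ∈ Δ, HasProportionalLower α x := by
  obtain ⟨U, hU, b, hb, hfreq⟩ := exists_separated_of_htop_pos h
  obtain ⟨Ω, hΩ, δ, hδ, hΩU⟩ := exists_evalEntourage_subset hec hei hΔ hU
  obtain ⟨η, rfl⟩ : ∃ η, δ = 10 * η := ⟨δ / 10, by ring⟩
  have hη : 0 < η := by linarith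
  obtain ⟨Q, hQ, hQΩ⟩ := exists_finset_value_pairs 𝕜 Ω hη
  have separate {n : ℕ} {s : Finset K}
      (hs : (s : Set K).Pairwise fun p q => ∃ i < n, (T^[i] p, T^[i] q) ∉ U) :
      PairsSeparate (nearValue α e η) (Finset.range n ×ˢ Q) (s : Set K) :=
    pairsSeparate_nearValue he hQΩ (hs.mono' fun p q ⟨i, hi, hpq⟩ => ⟨i, hi, fun h => hpq (hΩU h)⟩)
  have hQne : Q.Nonempty := by
    obtain ⟨n, s, hexp, hs⟩ := hfreq.exists
    have hcard : (1 : ℝ) < s.card := (Real.one_le_exp (by positivity)).trans_lt hexp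
    obtain ⟨p, hp, q, hq, hpq⟩ := Finset.one_lt_card.mp (Nat.one_lt_cast.mp hcard)
    obtain ⟨j, hj, -⟩ := separate hs hp hq hpq
    exact ⟨j.2, (Finset.mem_product.mp hj).2⟩
  have hQcard : (0 : ℝ) < Q.card := Nat.cast_pos.mpr hQne.card_pos
  obtain ⟨c, hc, hshatter⟩ := exists_shattersPairs_of_exp_lt_card (div_pos hb hQcard)
  have lower : ∃ᶠ n : ℕ in atTop, ∃ x ∈ Ω, ∃ J ⊆ Finset.range n, c * n ≤ J.card ∧
      EllOneLower 𝕜 (fun i : ℕ => (α ^ i : X ≃ₗᵢ[𝕜] X) x) η J := by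
    refine hfreq.mono fun n ⟨s, hexp, hs⟩ => ?_
    obtain ⟨J, hJ, hJcard, hJs⟩ := hshatter (nearValue α e η) (Finset.range n ×ˢ Q) s
      (fun j hj => disjoint_nearValue hη (hQ j.2 (Finset.mem_product.mp hj).2).2) (separate hs)
      (by
        rw [Finset.card_product, Finset.card_range, Nat.cast_mul, ← mul_assoc, mul_right_comm,
          div_mul_cancel₀ b hQcard.ne']
        exact hexp)
    obtain ⟨q, hq, J', hJ'n, hJ'card, hJ'⟩ := exists_large_fiber hJ hQne hJcard
    rw [Finset.card_range] at hJ'card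
    exact ⟨q.1, (hQ q hq).1, J', hJ'n, hJ'card, hJs.ellOneLower hJ' (hQ q hq).2⟩
  obtain ⟨x, hx, hfreq⟩ := (frequently_exists_finset Ω).mp lower
  exact ⟨x, hΩ hx, η, c, hη, hc, hfreq⟩

end PositiveEntropy

section Norming

variable {𝕜 X : Type*} [RCLike 𝕜] [NormedAddCommGroup X] [NormedSpace 𝕜 X]

theorem exists_norming_of_isInducing {Z : Set (DualBall 𝕜 X)} (hZ : IsClosed Z)
    (h : Topology.IsInducing (evalOn Z)) :
    ∃ κ : ℝ, 0 < κ ∧ ∀ v : X, v ≠ 0 → ∃ p : Z, κ * ‖v‖ ≤ ‖p.1.1 v‖ := by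
  have : CompactSpace Z := isCompact_iff_compactSpace.mp hZ.isCompact
  let evalMap : X →L[𝕜] C(Z, 𝕜) :=
    { toFun := evalOn Z
      map_add' := fun x y => ContinuousMap.ext fun p => map_add p.1.1 x y
      map_smul' := fun c x => ContinuousMap.ext fun p => map_smul p.1.1 c x
      cont := h.continuous }
  obtain ⟨C, hC⟩ := evalMap.antilipschitz_of_isEmbedding h.isEmbedding
  have hC0 : (0 : ℝ) < C + 1 := by positivity
  refine ⟨(C + 1 : ℝ)⁻¹, inv_pos.mpr hC0, fun v hv => ?_⟩
  by_contra! hsmall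
  have hle : ‖evalMap v‖ ≤ (C + 1 : ℝ)⁻¹ * ‖v‖ :=
    (ContinuousMap.norm_le _ (by positivity)).mpr fun p => (hsmall p).le
  have : ‖v‖ < ‖v‖ :=
    calc ‖v‖ ≤ C * ‖evalMap v‖ := evalMap.bound_of_antilipschitz hC v
      _ ≤ C * ((C + 1 : ℝ)⁻¹ * ‖v‖) := by gcongr
      _ = C / (C + 1) * ‖v‖ := by ring
      _ < 1 * ‖v‖ := by
        have := norm_pos_iff.mpr hv
        gcongr
        exact (div_lt_one hC0).mpr (lt_add_one _)
      _ = ‖v‖ := one_mul _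
  exact this.false

end Norming

end CAEntropy

end

theorem theorem3_general {𝕜 X Y : Type*} [RCLike 𝕜]
    [NormedAddCommGroup X] [NormedSpace 𝕜 X] [CompleteSpace X]
    [NormedAddCommGroup Y] [NormedSpace 𝕜 Y]
    (ι : X →ₗᵢ[𝕜] Y) (hι : CAEntropy.IsCAEmbedding ι)
    (α : X ≃ₗᵢ[𝕜] X)
    (Z : Set (CAEntropy.DualBall 𝕜 X)) (hZ : IsClosed Z)
    (hZinv : Set.MapsTo (CAEntropy.dualHomeo α) Z Z)
    (hZind : Topology.IsInducing (CAEntropy.evalOn Z))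
    (Δ : Set X) (hΔ : (Submodule.span 𝕜 Δ).topologicalClosure = ⊤) :
    List.TFAE
      [0 < CAEntropy.hc ι α,
       0 < CAEntropy.htop (CAEntropy.dualHomeo (𝕜 := 𝕜) α),
       CAEntropy.htop (CAEntropy.dualHomeo (𝕜 := 𝕜) α) = ⊤,
       ∃ x : X, CAEntropy.HasProportionalEllOnePieces α x,
       ∃ x : X, CAEntropy.HasPositiveDensityEllOneSet α x,
       0 < CAEntropy.htopRestrict (CAEntropy.dualHomeo α) Z hZ hZinv,
       ∃ x ∈ Δ, CAEntropy.HasProportionalEllOnePieces α x,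
       ∃ x ∈ Δ, CAEntropy.HasPositiveDensityEllOneSet α x] := by
  have : CompactSpace Z := isCompact_iff_compactSpace.mp hZ.isCompact
  tfae_have 1 → 2 := fun h => h.trans_le (CAEntropy.hc_le_htop hι α)
  tfae_have 2 → 7 := fun h =>
    let ⟨x, hx, hlower⟩ := CAEntropy.exists_hasProportionalLower_of_htop_pos continuous_id
      Function.injective_id Function.Semiconj.id_left hΔ h
    ⟨x, hx, hlower.hasProportionalEllOnePieces⟩
  tfae_have 6 → 7 := fun h =>
    let ⟨x, hx, hlower⟩ := CAEntropy.exists_hasProportionalLower_of_htop_pos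
      (T := hZinv.restrict (CAEntropy.dualHomeo α) Z Z) continuous_subtype_val
      Subtype.val_injective (fun _ => rfl) hΔ h
    ⟨x, hx, hlower.hasProportionalEllOnePieces⟩
  tfae_have 7 → 8 := fun ⟨x, hx, h⟩ => ⟨x, hx, h.hasProportionalLower.hasPositiveDensityEllOneSet⟩
  tfae_have 8 → 5 := fun ⟨x, _, h⟩ => ⟨x, h⟩
  tfae_have 5 → 4 := fun ⟨x, h⟩ => ⟨x, h.hasProportionalLower.hasProportionalEllOnePieces⟩
  tfae_have 4 → 3 := fun ⟨_, h⟩ => h.hasProportionalLower.htop_eq_top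
  tfae_have 3 → 2 := fun h => h ▸ EReal.zero_lt_top
  tfae_have 4 → 1 := fun ⟨_, h⟩ => h.hasProportionalLower.hc_pos ι
  tfae_have 4 → 6 := fun ⟨_, h⟩ =>
    let ⟨_, hκ, hnorm⟩ := CAEntropy.exists_norming_of_isInducing hZ hZind
    h.hasProportionalLower.htop_pos continuous_subtype_val (fun _ => rfl) hκ hnorm
  tfae_finish

theorem theorem3 {𝕜 X Y : Type*} [RCLike 𝕜]
    [NormedAddCommGroup X] [NormedSpace 𝕜 X] [CompleteSpace X]
    [NormedAddCommGroup Y] [NormedSpace 𝕜 Y] [CompleteSpace Y]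
    (ι : X →ₗᵢ[𝕜] Y) (hι : CAEntropy.IsCAEmbedding ι)
    (α : X ≃ₗᵢ[𝕜] X)
    (Z : Set (CAEntropy.DualBall 𝕜 X)) (hZ : IsClosed Z)
    (hZinv : Set.MapsTo (CAEntropy.dualHomeo α) Z Z)
    (hZemb : Topology.IsClosedEmbedding (CAEntropy.evalOn Z))
    (Δ : Set X) (hΔ : (Submodule.span 𝕜 Δ).topologicalClosure = ⊤) :
    List.TFAE
      [0 < CAEntropy.hc ι α,
       0 < CAEntropy.htop (CAEntropy.dualHomeo (𝕜 := 𝕜) α),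
       CAEntropy.htop (CAEntropy.dualHomeo (𝕜 := 𝕜) α) = ⊤,
       ∃ x : X, CAEntropy.HasProportionalEllOnePieces α x,
       ∃ x : X, CAEntropy.HasPositiveDensityEllOneSet α x,
       0 < CAEntropy.htopRestrict (CAEntropy.dualHomeo α) Z hZ hZinv,
       ∃ x ∈ Δ, CAEntropy.HasProportionalEllOnePieces α x,
       ∃ x ∈ Δ, CAEntropy.HasPositiveDensityEllOneSet α x] :=
  theorem3_general ι hι α Z hZ hZinv hZemb.isInducing Δ hΔ
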